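/- Let $\Sigma$ be a finite alphabet. Formulas over $\Sigma$ are built by $\varphi ::= \bot \mid p_i \mid \varphi\to\psi \mid [e]\varphi$ ($i<\omega$, $e\in\Sigma$) and are interpreted in the usual way in Kripke models $M=(W,(R_e)_{e\in\Sigma},V)$ with $W\neq\varnothing$. A *logic* over $\Sigma$ is a set of formulas that contains all classical tautologies and the formulas $[e](p\to q)\to([e]p\to[e]q)$ and is closed under modus ponens, substitution and necessitation for each $[e]$. $\mathsf{Mod}(L)$ is the class of models in which all formulas of $L$ are true at all points. For a model $M$ and a set of formulas $\Phi$, write $x\sim_\Phi y$ if $x$ and $y$ satisfy the same formulas of $\Phi$ in $M$. Let $\Gamma$ be a finite set of formulas closed under subformulas. A *definable $\Gamma$-filtration* of $M$ is a model $\widehat M=(W/{\sim},(\widehat R_e)_{e\in\Sigma},\widehat V)$ such that ${\sim}={\sim_\Phi}$ for some finite set $\Phi$ of formulas; ${\sim}\subseteq{\sim_\Gamma}$; for all letters $p\in\Gamma$ and $x\in W$, $\widehat M,[x]\models p$ iff $M,x\models p$; $xR_ey$ implies $[x]\widehat R_e[y]$; and whenever $[x]\widehat R_e[y]$, $[e]\varphi\in\Gamma$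 and $M,x\models[e]\varphi$, then $M,y\models\varphi$. A class $\mathcal M$ of models *admits definable filtration* if for every finite subformula-closed $\Gamma$, every $M\in\mathcal M$ has a definable $\Gamma$-filtration that belongs to $\mathcal M$. Let $\Sigma^\sharp$ be $\Sigma$ together with new symbols $e\circ c$, $e\cup c$, $e^+$ for all $e,c\in\Sigma$. For a logic $L$ over $\Sigma$, let $L^\sharp$ be the smallest logic over $\Sigma^\sharp$ that contains $L$ and, for all $e,c\in\Sigma$, the formulas $$[e\cup c]p\leftrightarrow[e]p\wedge[c]p,\qquad [e\circ c]p\leftrightarrow[e][c]p,$$ $$[e^+]p\to[e]p,\qquad [e^+]p\to[e][e^+]p,\qquad [e^+](p\to[e]p)\to([e]p\to[e^+]p).$$ Put $L^{(0)}=L$ and $L^{(n+1)}=(L^{(n)})^\sharp$. **Theorem.** Let $L$ be a logic over a finite alphabet $\Sigma$ such that $\mathsf{Mod}(L)$ admits definable filtration. Then for every $n<\omega$: 1. $\mathsf{Mod}(L^{(n)})$ admits definable filtration. 2. $L^{(n)}$ has the finite model property (it is the set of formulas valid in all frames of some class of finite frames), and hence is Kripke complete (it is the set of formulas valid in all frames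 of some class of frames). 3. If $L$ is finitely axiomatizable (it is the smallest logic over $\Sigma$ that contains some finite set of formulas), then $L^{(n)}$ is decidable. 4. If the class of finite $L$-frames is decidable (there is an algorithm that decides, given a finite frame $(W,(R_e)_{e\in\Sigma})$, whether all formulas of $L$ are valid in it), then $L^{(n)}$ is co-recursively enumerable. -/

import Mathlib

universe u

namespace ModalLogic

/-- Modal formulas over an alphabet `S`: `⊥ | pᵢ | φ → ψ | [e]φ`. -/
inductive Formula (S : Type) : Type
  | bot : Formula S
  | var : ℕ → Formula S
  | imp : Formula S → Formula S → Formula S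
  | box : S → Formula S → Formula S

namespace Formula

variable {S T : Type}

/-- `¬ φ` -/
def neg (φ : Formula S) : Formula S := imp φ bot

/-- `φ ∧ ψ` -/
def and (φ ψ : Formula S) : Formula S := neg (imp φ (neg ψ))

/-- `φ ↔ ψ` -/
def iff (φ ψ : Formula S) : Formula S := and (imp φ ψ) (imp ψ φ)

/-- Uniform substitution of formulas for the propositional letters. -/
def subst (σ : ℕ → Formula S) : Formula S → Formula S
  | bot => bot
  | var i => σ i
  | imp φ ψ => imp (subst σ φ) (subst σ ψ)
  | box e φ => box e (subst σ φ)

/-- Renaming of the modalities along a map of alphabets. -/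
def mapAlphabet (f : S → T) : Formula S → Formula T
  | bot => bot
  | var i => var i
  | imp φ ψ => imp (mapAlphabet f φ) (mapAlphabet f ψ)
  | box e φ => box (f e) (mapAlphabet f φ)

/-- The set of all subformulas of a formula. -/
def sub : Formula S → Set (Formula S)
  | bot => {bot}
  | var i => {var i}
  | imp φ ψ => {imp φ ψ} ∪ sub φ ∪ sub ψ
  | box e φ => {box e φ} ∪ sub φ

/-- A (classical) tautology: true under every Boolean truth assignment, where letters and
boxed formulas are treated as atoms. -/
def IsTautology (φ : Formula S) : Prop :=
  ∀ v : Formula S → Prop, ¬ v bot → (∀ ψ χ, v (imp ψ χ) ↔ (v ψ → v χ)) → v φ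

/-- Gödel number of a formula, relative to a numbering `ι` of the alphabet. -/
def code (ι : S → ℕ) : Formula S → ℕ
  | bot => Nat.pair 0 0
  | var i => Nat.pair 1 i
  | imp φ ψ => Nat.pair 2 (Nat.pair (code ι φ) (code ι ψ))
  | box e φ => Nat.pair 3 (Nat.pair (ι e) (code ι φ))

theorem code_injective {ι : S → ℕ} (hι : Function.Injective ι) :
    Function.Injective (code ι) := by
  intro φ
  induction φ with
  | bot => intro ψ h; cases ψ <;> simp [code, Nat.pair_eq_pair] at h ⊢
  | var i => intro ψ h; cases ψ <;> simp [code, Nat.pair_eq_pair] at h ⊢; exact h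
  | imp a b iha ihb =>
    intro ψ h
    cases ψ <;> simp [code, Nat.pair_eq_pair] at h ⊢
    exact ⟨iha h.1, ihb h.2⟩
  | box e a iha =>
    intro ψ h
    cases ψ <;> simp [code, Nat.pair_eq_pair] at h ⊢
    exact ⟨hι h.1, iha h.2⟩

end Formula

open Formula

/-- `Γ` contains every subformula of each of its members. -/
def SubClosed {S : Type} (Γ : Set (Formula S)) : Prop :=
  ∀ φ ∈ Γ, sub φ ⊆ Γ

/-! ### Logics -/

/-- Normal modal logics over the alphabet `S`. -/
structure IsNormalLogic {S : Type} (L : Set (Formula S)) : Prop where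
  taut : ∀ φ, IsTautology φ → φ ∈ L
  axiomK : ∀ e : S,
    imp (box e (imp (var 0) (var 1))) (imp (box e (var 0)) (box e (var 1))) ∈ L
  mp : ∀ φ ψ, imp φ ψ ∈ L → φ ∈ L → ψ ∈ L
  subst : ∀ (σ : ℕ → Formula S) (φ), φ ∈ L → φ.subst σ ∈ L
  nec : ∀ (e : S) (φ), φ ∈ L → box e φ ∈ L

/-- The smallest normal logic that contains `A`. -/
def smallestLogic {S : Type} (A : Set (Formula S)) : Set (Formula S) :=
  {φ | ∀ L : Set (Formula S), IsNormalLogic L → A ⊆ L → φ ∈ L}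

theorem isNormalLogic_smallestLogic {S : Type} (A : Set (Formula S)) :
    IsNormalLogic (smallestLogic A) where
  taut φ h _ hL _ := hL.taut φ h
  axiomK e _ hL _ := hL.axiomK e
  mp φ ψ h h' L hL hA := hL.mp φ ψ (h L hL hA) (h' L hL hA)
  subst σ φ h L hL hA := hL.subst σ φ (h L hL hA)
  nec e φ h L hL hA := hL.nec e φ (h L hL hA)

/-- `L` is the smallest normal logic that contains some finite set of formulas. -/
def FinitelyAxiomatizable {S : Type} (L : Set (Formula S)) : Prop :=
  ∃ A : Set (Formula S), A.Finite ∧ L = smallestLogic A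

/-! ### Frames and models -/

/-- Kripke frames over the alphabet `S` with (non-empty) set of points `W`. -/
structure Frame (S : Type) (W : Type u) where
  nonempty : Nonempty W
  rel : S → W → W → Prop

/-- Kripke models over the alphabet `S` with (non-empty) set of points `W`. -/
structure Model (S : Type) (W : Type u) extends Frame S W where
  val : ℕ → W → Prop

variable {S : Type} {W : Type u}

/-- The truth relation `M, x ⊨ φ`. -/
def Model.Sat (M : Model S W) : W → Formula S → Prop
  | _, .bot => False
  | x, .var i => M.val i x
  | x, .imp φ ψ => M.Sat x φ → M.Sat x ψ
  | x, .box e φ => ∀ y, M.rel e x y → M.Sat y φ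

/-- `M ⊨ φ` for all `φ ∈ L`. -/
def Model.Models (M : Model S W) (L : Set (Formula S)) : Prop :=
  ∀ φ ∈ L, ∀ x, M.Sat x φ

/-- `F ⊨ φ`: the formula `φ` is true at all points under all valuations on `F`. -/
def Frame.Valid (F : Frame S W) (φ : Formula S) : Prop :=
  ∀ (V : ℕ → W → Prop) (x : W), (Model.mk F V).Sat x φ

/-- `L` is the set of formulas that are valid in all members of some class of frames. -/
def KripkeComplete (L : Set (Formula S)) : Prop :=
  ∃ C : ∀ W : Type u, Set (Frame S W),
    L = {φ | ∀ (W : Type u) (F : Frame S W), F ∈ C W → F.Valid φ}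

/-- Finite model property: `L` is the set of formulas that are valid in all members of some
class of finite frames. -/
def HasFMP (L : Set (Formula S)) : Prop :=
  ∃ C : ∀ W : Type u, Set (Frame S W),
    (∀ W : Type u, (C W).Nonempty → Finite W) ∧
    L = {φ | ∀ (W : Type u) (F : Frame S W), F ∈ C W → F.Valid φ}

/-! ### Filtrations -/

/-- The equivalence relation on the points of `M` induced by a set of formulas. -/
def Model.equivOn (M : Model S W) (Γ : Set (Formula S)) : Setoid W where
  r x y := ∀ φ ∈ Γ, (M.Sat x φ ↔ M.Sat y φ)
  iseqv :=
    { refl := fun _ _ _ => Iff.rfl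
      symm := fun h φ hφ => (h φ hφ).symm
      trans := fun h h' φ hφ => (h φ hφ).trans (h' φ hφ) }

/-- `N` is a filtration of `M` with quotient set `W/s` that respects `Γ`. -/
structure IsFiltration (M : Model S W) (Γ : Set (Formula S)) (s : Setoid W)
    (N : Model S (Quotient s)) : Prop where
  finite_index : Finite (Quotient s)
  respects : ∀ x y, s x y → M.equivOn Γ x y
  val_iff : ∀ i, Formula.var i ∈ Γ → ∀ x : W, (N.val i (Quotient.mk s x) ↔ M.val i x)
  min_le : ∀ (e : S) (a b : Quotient s),
    (∃ x y, Quotient.mk s x = a ∧ Quotient.mk s y = b ∧ M.rel e x y) → N.rel e a b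
  le_max : ∀ (e : S) (x y : W), N.rel e (Quotient.mk s x) (Quotient.mk s y) →
    ∀ φ, Formula.box e φ ∈ Γ → M.Sat x (Formula.box e φ) → M.Sat y φ

/-- A class of models admits definable filtration: for every finite subformula-closed `Γ`, each
model `M` of the class has a `Γ`-filtration in the class whose equivalence relation is induced
by a finite set of formulas. -/
def AdmitsDefinableFiltration (C : ∀ W : Type u, Set (Model S W)) : Prop :=
  ∀ Γ : Set (Formula S), Γ.Finite → SubClosed Γ →
    ∀ (W : Type u) (M : Model S W), M ∈ C W →
      ∃ Φ : Set (Formula S), Φ.Finite ∧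
        ∃ N : Model S (Quotient (M.equivOn Φ)),
          N ∈ C (Quotient (M.equivOn Φ)) ∧ IsFiltration M Γ (M.equivOn Φ) N

/-- `Mod(L)`: the class of all models of `L`. -/
def Mod (L : Set (Formula S)) : ∀ W : Type u, Set (Model S W) :=
  fun _ => {M | M.Models L}

/-! ### PDL-like expansions -/

/-- The alphabet `S` together with fresh symbols `e ∘ c`, `e ∪ c` and `e⁺` for `e, c` in `S`. -/
inductive Sharp (S : Type) : Type
  | base : S → Sharp S
  | comp : S → S → Sharp S
  | union : S → S → Sharp S
  | plus : S → Sharp S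

/-- The PDL-like axioms over the expanded alphabet. -/
inductive PDLAxiom : Formula (Sharp S) → Prop
  | union (e c : S) : PDLAxiom
      (iff (box (.union e c) (var 0)) (and (box (.base e) (var 0)) (box (.base c) (var 0))))
  | comp (e c : S) : PDLAxiom
      (iff (box (.comp e c) (var 0)) (box (.base e) (box (.base c) (var 0))))
  | plus_sub (e : S) : PDLAxiom
      (imp (box (.plus e) (var 0)) (box (.base e) (var 0)))
  | plus_step (e : S) : PDLAxiom
      (imp (box (.plus e) (var 0)) (box (.base e) (box (.plus e) (var 0))))
  | plus_ind (e : S) : PDLAxiom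
      (imp (box (.plus e) (imp (var 0) (box (.base e) (var 0))))
        (imp (box (.base e) (var 0)) (box (.plus e) (var 0))))

/-- The smallest normal logic over the expanded alphabet that contains `L` and the PDL-like
axioms. -/
def sharpLogic (L : Set (Formula S)) : Set (Formula (Sharp S)) :=
  smallestLogic (mapAlphabet Sharp.base '' L ∪ {φ | PDLAxiom φ})

/-- The iterated alphabet `S⁽ⁿ⁾`. -/
def IterAlphabet (S : Type) : ℕ → Type
  | 0 => S
  | n + 1 => Sharp (IterAlphabet S n)

/-- The iterated expansion `L⁽ⁿ⁾`. -/
def iterLogic (L : Set (Formula S)) : ∀ n : ℕ, Set (Formula (IterAlphabet S n))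
  | 0 => L
  | n + 1 => sharpLogic (iterLogic L n)

instance finite_sharp [Finite S] : Finite (Sharp S) := by
  let f : S ⊕ (S × S) ⊕ (S × S) ⊕ S → Sharp S
    | .inl e => .base e
    | .inr (.inl p) => .comp p.1 p.2
    | .inr (.inr (.inl p)) => .union p.1 p.2
    | .inr (.inr (.inr e)) => .plus e
  refine Finite.of_surjective f ?_
  rintro (e | ⟨e, c⟩ | ⟨e, c⟩ | e)
  exacts [⟨.inl e, rfl⟩, ⟨.inr (.inl (e, c)), rfl⟩, ⟨.inr (.inr (.inl (e, c))), rfl⟩,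
    ⟨.inr (.inr (.inr e)), rfl⟩]

instance finite_iterAlphabet [h : Finite S] (n : ℕ) : Finite (IterAlphabet S n) := by
  induction n with
  | zero => exact h
  | succ n ih => exact @finite_sharp _ ih

/-! ### Decidability

Formulas are coded by natural numbers relative to an injective numbering of the finite alphabet.
Any two such numberings differ by a finite bijection, so the notions below do not depend on the
numbering; they are stated for all of them. -/

/-- A set of formulas over a finite alphabet is decidable. -/
def DecidableSet [Finite S] (L : Set (Formula S)) : Prop :=
  ∀ ι : S → ℕ, Function.Injective ι → ComputablePred fun n : ℕ => ∃ φ ∈ L, code ι φ = n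

/-- A set of formulas over a finite alphabet is co-recursively enumerable: the set of formulas
outside of it is recursively enumerable. -/
def CoRESet [Finite S] (L : Set (Formula S)) : Prop :=
  ∀ ι : S → ℕ, Function.Injective ι → REPred fun n : ℕ => ∃ φ, φ ∉ L ∧ code ι φ = n

/-- The finite frame presented by `(m, l)`: its points are `0, …, m`, and `l` is the list of all
triples `(ι e, i, j)` with `i Rₑ j` (other entries of `l` are ignored). -/
def presentedFrame (ι : S → ℕ) (d : ℕ × List (ℕ × ℕ × ℕ)) : Frame S (Fin (d.1 + 1)) where
  nonempty := ⟨0⟩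
  rel e i j := (ι e, (i : ℕ), (j : ℕ)) ∈ d.2

/-- Over a finite alphabet, every frame on `Fin (m + 1)` has a finite presentation. -/
theorem exists_presentedFrame [Finite S] {ι : S → ℕ} (hι : Function.Injective ι) (m : ℕ)
    (F : Frame S (Fin (m + 1))) : ∃ l, presentedFrame ι (m, l) = F := by
  have hfin : {t : S × Fin (m + 1) × Fin (m + 1) | F.rel t.1 t.2.1 t.2.2}.Finite :=
    Set.toFinite _
  refine ⟨hfin.toFinset.toList.map fun t => (ι t.1, (t.2.1 : ℕ), (t.2.2 : ℕ)), ?_⟩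
  cases F with
  | mk hne rel =>
    unfold presentedFrame
    congr
    funext e i j
    simp only [List.mem_map, Finset.mem_toList, Set.Finite.mem_toFinset, Set.mem_ofPred_eq,
      Prod.mk.injEq, Prod.exists, eq_iff_iff]
    constructor
    · rintro ⟨e', i', j', h, h1, h2, h3⟩
      rwa [← hι h1, ← Fin.ext h2, ← Fin.ext h3]
    · exact fun h => ⟨e, i, j, h, rfl, rfl, rfl⟩

/-- The class of finite frames of `L` is decidable: there is an algorithm that decides, given a
finite presentation of a finite frame, whether the frame validates `L`. -/
def DecidableFiniteFrames [Finite S] (L : Set (Formula S)) : Prop :=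
  ∀ ι : S → ℕ, Function.Injective ι →
    ComputablePred fun d : ℕ × List (ℕ × ℕ × ℕ) => ∀ φ ∈ L, (presentedFrame ι d).Valid φ

end ModalLogic

/-! The heart of the matter is that definable filtration survives one expansion step
(`AdmitsDefinableFiltration.sharp`). The remaining claims hold for any normal logic with definable
filtration, once their side conditions are known to pass to expansions.

Let `M` be a model of the expanded logic. Name by letters the finitely many formulas of `Γ` and all
`[e]φ` with `φ ∈ Γ` and `e` a base symbol. The base reduct of `M`, with these letters, is a model of
`L`, because `L` is closed under substitution. Filtrate it and interpret `e ∘ c`, `e ∪ c`, `e⁺` in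
the finite quotient as composition, union and transitive closure. The new relations contain the
images of the old ones: any set of classes is defined in `M` by a formula, and the axioms, notably
induction for `e⁺`, can be applied to that formula (`sharp_rel_of_models`). The upper condition on
`Γ` follows by unfolding boxes with the axioms and moving along base steps. The result is a model of
the expanded logic because, in a finite model, `[e⁺]` is a finite conjunction of iterates of `[e]`,
so every new formula is equivalent to a base formula (`exists_equivalent`, `sharp_models`).

For the finite model property, the canonical model refutes a non-theorem and a filtration makes the
countermodel finite. Identifying modally equivalent points then makes every subset definable, so
that truth of a substitution-closed set becomes validity in the frame (`Model.collapse_valid`).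

A non-theorem is thus witnessed by a finite frame of the logic and a valuation, which gives
co-enumerability when finite frames are decidable. A finite axiomatization makes finite frames
decidable and also makes the logic enumerable, by a Hilbert calculus; Post's theorem then gives
decidability. -/

namespace ModalLogic

open Formula

variable {S T : Type} {W : Type u}

/-! ### Theories and valuations -/

/-- Sets of formulas that contain an axiomatization of classical propositional logic and are closed
under modus ponens. -/
structure IsTheory (B : Set (Formula S)) : Prop where
  weaken : ∀ φ ψ, imp φ (imp ψ φ) ∈ B
  distrib : ∀ φ ψ χ, imp (imp φ (imp ψ χ)) (imp (imp φ ψ) (imp φ χ)) ∈ B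
  exfalso : ∀ φ, imp bot φ ∈ B
  cases : ∀ φ ψ χ, imp (imp ψ φ) (imp (imp (imp ψ χ) φ) φ) ∈ B
  mp : ∀ φ ψ, imp φ ψ ∈ B → φ ∈ B → ψ ∈ B

/-- Boolean truth assignments. -/
def IsValuation (v : Formula S → Prop) : Prop :=
  ¬ v bot ∧ ∀ ψ χ, v (imp ψ χ) ↔ (v ψ → v χ)

theorem IsTheory.adjoin {B : Set (Formula S)} (hB : IsTheory B) (ψ : Formula S) :
    IsTheory {χ | imp ψ χ ∈ B} := by
  have h : ∀ χ ∈ B, imp ψ χ ∈ B := fun χ hχ => hB.mp _ _ (hB.weaken χ ψ) hχ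
  exact ⟨fun a b => h _ (hB.weaken a b), fun a b c => h _ (hB.distrib a b c),
    fun a => h _ (hB.exfalso a), fun a b c => h _ (hB.cases a b c),
    fun a b hab ha => hB.mp _ _ (hB.mp _ _ (hB.distrib ψ a b) hab) ha⟩

theorem IsTheory.imp_self {B : Set (Formula S)} (hB : IsTheory B) (ψ : Formula S) :
    imp ψ ψ ∈ B :=
  hB.mp _ _ (hB.mp _ _ (hB.distrib ψ (imp ψ ψ) ψ) (hB.weaken ψ (imp ψ ψ))) (hB.weaken ψ ψ)

/-- If `ψ ∉ B`, adjoining `ψ` gives a strictly larger theory, which must contain `φ`; so `ψ → φ ∈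
B`. If an implication fails to be in `B` although it should be, then `ψ` and `ψ → χ` are both
outside `B`, so both imply `φ`, and the case axiom puts `φ` into `B`. -/
theorem IsTheory.isValuation_of_maximal {B : Set (Formula S)} {φ : Formula S}
    (hB : Maximal (fun C : Set (Formula S) => IsTheory C ∧ φ ∉ C) B) :
    IsValuation (· ∈ B) := by
  obtain ⟨⟨hT, hφ⟩, hmax⟩ := hB
  have key : ∀ ψ, ψ ∉ B → imp ψ φ ∈ B := by
    intro ψ hψ
    by_contra hc
    exact hψ (hmax (y := {χ | imp ψ χ ∈ B}) ⟨hT.adjoin ψ, hc⟩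
      (fun χ hχ => hT.mp _ _ (hT.weaken χ ψ) hχ) (hT.imp_self ψ))
  refine ⟨fun h => hφ (hT.mp _ _ (hT.exfalso φ) h), fun ψ χ => ⟨hT.mp ψ χ, fun h => ?_⟩⟩
  by_contra hc
  by_cases hχ : χ ∈ B
  · exact hc (hT.mp _ _ (hT.weaken χ ψ) hχ)
  · exact hφ (hT.mp _ _ (hT.mp _ _ (hT.cases φ ψ χ) (key ψ fun h' => hχ (h h'))) (key _ hc))

/-- Lindenbaum's lemma. -/
theorem IsTheory.exists_valuation {A : Set (Formula S)} (hA : IsTheory A) {φ : Formula S}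
    (hφ : φ ∉ A) : ∃ v : Formula S → Prop, IsValuation v ∧ (∀ ψ ∈ A, v ψ) ∧ ¬ v φ := by
  obtain ⟨B, hAB, hB⟩ := zorn_subset_nonempty {C : Set (Formula S) | IsTheory C ∧ φ ∉ C}
    (by
      intro c hc hchain hne
      obtain ⟨C₀, hC₀⟩ := hne
      refine ⟨⋃₀ c, ⟨⟨?_, ?_, ?_, ?_, ?_⟩, ?_⟩, fun s hs => Set.subset_sUnion_of_mem hs⟩
      · exact fun a b => ⟨C₀, hC₀, (hc hC₀).1.weaken a b⟩
      · exact fun a b d => ⟨C₀, hC₀, (hc hC₀).1.distrib a b d⟩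
      · exact fun a => ⟨C₀, hC₀, (hc hC₀).1.exfalso a⟩
      · exact fun a b d => ⟨C₀, hC₀, (hc hC₀).1.cases a b d⟩
      · rintro a b ⟨C, hC, h1⟩ ⟨D, hD, h2⟩
        rcases hchain.total hC hD with h | h
        · exact ⟨D, hD, (hc hD).1.mp _ _ (h h1) h2⟩
        · exact ⟨C, hC, (hc hC).1.mp _ _ h1 (h h2)⟩
      · rintro ⟨C, hC, h⟩
        exact (hc hC).2 h) A ⟨hA, hφ⟩
  exact ⟨(· ∈ B), IsTheory.isValuation_of_maximal hB, fun ψ h => hAB h, hB.prop.2⟩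

theorem IsNormalLogic.isTheory {L : Set (Formula S)} (hL : IsNormalLogic L) : IsTheory L where
  weaken φ ψ := hL.taut _ fun v _ h => by simp only [h]; tauto
  distrib φ ψ χ := hL.taut _ fun v _ h => by simp only [h]; tauto
  exfalso φ := hL.taut _ fun v h0 h => by simp only [h]; tauto
  cases φ ψ χ := hL.taut _ fun v _ h => by simp only [h]; tauto
  mp := hL.mp

/-! ### The canonical model -/

/-- The points of the canonical model of `L`. -/
def CanonicalPoint (L : Set (Formula S)) : Type u :=
  ULift.{u} {v : Formula S → Prop // IsValuation v ∧ ∀ φ ∈ L, v φ}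

/-- The canonical model of `L`. -/
def canonicalModel (L : Set (Formula S)) (h : Nonempty (CanonicalPoint.{u} L)) :
    Model S (CanonicalPoint.{u} L) where
  nonempty := h
  rel e x y := ∀ φ, x.down.1 (box e φ) → y.down.1 φ
  val i x := x.down.1 (var i)

theorem IsNormalLogic.box_mp {L : Set (Formula S)} (hL : IsNormalLogic L) (e : S)
    (φ ψ : Formula S) : imp (box e (imp φ ψ)) (imp (box e φ) (box e ψ)) ∈ L :=
  hL.subst (fun i => if i = 0 then φ else ψ) _ (hL.axiomK e)

/-- The truth lemma. If `[e]φ` fails at `x`, the formulas boxed true at `x` form a theory that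
contains `L` and omits `φ`, and Lindenbaum's lemma turns it into a successor refuting `φ`. -/
theorem canonicalModel_sat {L : Set (Formula S)} (hL : IsNormalLogic L)
    (h : Nonempty (CanonicalPoint.{u} L)) (φ : Formula S) :
    ∀ x, (canonicalModel L h).Sat x φ ↔ x.down.1 φ := by
  induction φ with
  | bot => exact fun x => ⟨False.elim, x.down.2.1.1⟩
  | var i => exact fun x => Iff.rfl
  | imp φ ψ ih1 ih2 => intro x; rw [x.down.2.1.2, ← ih1, ← ih2]; rfl
  | box e φ ih =>
    intro x
    refine ⟨fun hx => ?_, fun hx y hy => (ih y).2 (hy φ hx)⟩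
    by_contra hc
    have hnec : ∀ ψ ∈ L, x.down.1 (box e ψ) := fun ψ hψ => x.down.2.2 _ (hL.nec e ψ hψ)
    have hT : IsTheory {ψ | x.down.1 (box e ψ)} := by
      have hT := hL.isTheory
      refine ⟨fun a b => hnec _ (hT.weaken a b), fun a b c => hnec _ (hT.distrib a b c),
        fun a => hnec _ (hT.exfalso a), fun a b c => hnec _ (hT.cases a b c),
        fun a b h1 h2 => ?_⟩
      have h3 := x.down.2.2 _ (hL.box_mp e a b)
      rw [x.down.2.1.2, x.down.2.1.2] at h3
      exact h3 h1 h2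
    obtain ⟨v, hv, hvT, hvφ⟩ := hT.exists_valuation hc
    exact hvφ ((ih ⟨v, hv, fun ψ hψ => hvT ψ (hnec ψ hψ)⟩).1 (hx _ hvT))

/-- Every normal logic is complete with respect to its models. -/
theorem IsNormalLogic.exists_model {L : Set (Formula S)} (hL : IsNormalLogic L) {φ : Formula S}
    (hφ : φ ∉ L) : ∃ (W : Type u) (M : Model S W) (x : W), M.Models L ∧ ¬ M.Sat x φ := by
  obtain ⟨v, hv, hvL, hvφ⟩ := hL.isTheory.exists_valuation hφ
  let x : CanonicalPoint.{u} L := ⟨v, hv, hvL⟩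
  exact ⟨_, canonicalModel L ⟨x⟩, x,
    fun ψ hψ y => (canonicalModel_sat hL _ ψ y).2 (y.down.2.2 ψ hψ),
    fun h => hvφ ((canonicalModel_sat hL _ φ x).1 h)⟩

/-! ### Truth and definability -/

theorem Model.sat_imp (M : Model S W) (x : W) (φ ψ : Formula S) :
    M.Sat x (imp φ ψ) ↔ (M.Sat x φ → M.Sat x ψ) := Iff.rfl

theorem Model.sat_box (M : Model S W) (x : W) (e : S) (φ : Formula S) :
    M.Sat x (box e φ) ↔ ∀ y, M.rel e x y → M.Sat y φ := Iff.rfl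

theorem Model.sat_neg (M : Model S W) (x : W) (φ : Formula S) :
    M.Sat x (neg φ) ↔ ¬ M.Sat x φ := Iff.rfl

theorem Model.sat_and (M : Model S W) (x : W) (φ ψ : Formula S) :
    M.Sat x (Formula.and φ ψ) ↔ M.Sat x φ ∧ M.Sat x ψ := by
  simp only [Formula.and, Model.sat_neg, Model.sat_imp]; tauto

theorem Model.sat_iff (M : Model S W) (x : W) (φ ψ : Formula S) :
    M.Sat x (Formula.iff φ ψ) ↔ (M.Sat x φ ↔ M.Sat x ψ) := by
  simp only [Formula.iff, Model.sat_and, Model.sat_imp]; tauto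

/-- The model obtained by interpreting the letter `i` as the formula `σ i`. -/
def Model.substVal (M : Model S W) (σ : ℕ → Formula S) : Model S W :=
  ⟨M.toFrame, fun i x => M.Sat x (σ i)⟩

theorem Model.sat_subst (M : Model S W) (σ : ℕ → Formula S) (φ : Formula S) :
    ∀ x, M.Sat x (φ.subst σ) ↔ (M.substVal σ).Sat x φ := by
  induction φ with
  | bot => exact fun _ => Iff.rfl
  | var i => exact fun _ => Iff.rfl
  | imp φ ψ ih1 ih2 => exact fun x => imp_congr (ih1 x) (ih2 x)
  | box e φ ih => exact fun x => forall_congr' fun y => imp_congr_right fun _ => ih y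

/-- The reduct of a frame along a map of alphabets. -/
def Frame.reduct (f : S → T) (F : Frame T W) : Frame S W := ⟨F.nonempty, fun e => F.rel (f e)⟩

theorem sat_mapAlphabet (f : S → T) (F : Frame T W) (V : ℕ → W → Prop) (φ : Formula S) :
    ∀ x, (Model.mk F V).Sat x (φ.mapAlphabet f) ↔ (Model.mk (F.reduct f) V).Sat x φ := by
  induction φ with
  | bot => exact fun _ => Iff.rfl
  | var i => exact fun _ => Iff.rfl
  | imp φ ψ ih1 ih2 => exact fun x => imp_congr (ih1 x) (ih2 x)
  | box e φ ih => exact fun x => forall_congr' fun y => imp_congr_right fun _ => ih y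

theorem Frame.sat_congr {F : Frame S W} {V V' : ℕ → W → Prop} (h : ∀ i x, V i x ↔ V' i x)
    {x : W} {φ : Formula S} (hx : (Model.mk F V).Sat x φ) : (Model.mk F V').Sat x φ := by
  have : V = V' := funext fun i => funext fun x => propext (h i x)
  rwa [← this]

/-- Formulas true in a model under all substitutions form a normal logic. -/
theorem Model.isNormalLogic_subst (M : Model S W) :
    IsNormalLogic {φ | ∀ (σ : ℕ → Formula S) (x : W), (M.substVal σ).Sat x φ} where
  taut φ h σ x := h (fun ψ => (M.substVal σ).Sat x ψ) (fun h => h) fun _ _ => Iff.rfl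
  axiomK e σ x h h' y hy := h y hy (h' y hy)
  mp φ ψ h h' σ x := h σ x (h' σ x)
  subst τ φ h σ x := by
    rw [Model.sat_subst]
    exact Frame.sat_congr (fun i y => Model.sat_subst M σ (τ i) y) (h (fun i => (τ i).subst σ) x)
  nec e φ h σ x y _ := h σ y

/-- Formulas valid in a frame form a normal logic. -/
theorem Frame.isNormalLogic_valid (F : Frame S W) : IsNormalLogic {φ | F.Valid φ} where
  taut φ h V x := h (fun ψ => (Model.mk F V).Sat x ψ) (fun h => h) fun _ _ => Iff.rfl
  axiomK e V x h h' y hy := h y hy (h' y hy)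
  mp φ ψ h h' V x := h V x (h' V x)
  subst τ φ h V x := by
    rw [Model.sat_subst]
    exact h _ x
  nec e φ h V x y _ := h V y

/-- Finite conjunctions. -/
theorem exists_finite_conj {ι : Type*} [Finite ι] (f : ι → Formula S) :
    ∃ θ : Formula S, ∀ (W : Type u) (M : Model S W) (x : W),
      M.Sat x θ ↔ ∀ i, M.Sat x (f i) := by
  have key : ∀ l : List ι, ∃ θ : Formula S, ∀ (W : Type u) (M : Model S W) (x : W),
      M.Sat x θ ↔ ∀ i ∈ l, M.Sat x (f i) := by
    intro l
    induction l with
    | nil => exact ⟨neg bot, fun W M x => by simp [Model.sat_neg, Model.Sat]⟩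
    | cons a l ih =>
      obtain ⟨θ, hθ⟩ := ih
      exact ⟨Formula.and (f a) θ, fun W M x => by simp [Model.sat_and, hθ]⟩
  have := Fintype.ofFinite ι
  obtain ⟨θ, hθ⟩ := key Finset.univ.toList
  exact ⟨θ, fun W M x => by simp [hθ]⟩

/-- In a finite model, arbitrary conjunctions are expressible. -/
theorem Model.exists_conj [Finite W] (M : Model S W) {ι : Type} (f : ι → Formula S) :
    ∃ θ : Formula S, ∀ x : W, M.Sat x θ ↔ ∀ i, M.Sat x (f i) := by
  -- The index type may be infinite, but a finite model has only finitely many truth sets; one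
  -- representative index for each suffices.
  let g : ι → Set W := fun i => {x | M.Sat x (f i)}
  have hg : ∀ s : Set.range g, ∃ i, g i = s := fun s => s.2
  choose c hc using hg
  obtain ⟨θ, hθ⟩ := exists_finite_conj (fun s => f (c s))
  refine ⟨θ, fun x => (hθ W M x).trans ⟨fun h i => ?_, fun h s => h _⟩⟩
  have : x ∈ g (c ⟨g i, i, rfl⟩) := h ⟨g i, i, rfl⟩
  rw [hc] at this
  exact this

/-- Unions of classes of a finite-index equivalence induced by formulas are definable. -/
theorem Model.exists_definable (M : Model S W) (Φ : Set (Formula S))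
    [Finite (Quotient (M.equivOn Φ))] (P : Quotient (M.equivOn Φ) → Prop) :
    ∃ δ : Formula S, ∀ x, M.Sat x δ ↔ P (Quotient.mk _ x) := by
  -- Two distinct classes disagree on some member of `Φ`; that member or its negation holds on the
  -- first class and fails on the second.
  have hsep : ∀ p : Quotient (M.equivOn Φ) × Quotient (M.equivOn Φ), ∃ θ : Formula S,
      ∀ x, (Quotient.mk _ x = p.1 → M.Sat x θ) ∧
        (Quotient.mk _ x = p.2 → p.1 ≠ p.2 → ¬ M.Sat x θ) := by
    rintro ⟨a, b⟩
    by_cases hab : a = b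
    · exact ⟨neg bot, fun x => ⟨fun _ h => h, fun _ h => absurd hab h⟩⟩
    obtain ⟨y, rfl⟩ := Quotient.exists_rep a
    obtain ⟨z, rfl⟩ := Quotient.exists_rep b
    have : ¬ ∀ φ ∈ Φ, (M.Sat y φ ↔ M.Sat z φ) := fun h => hab (Quotient.sound h)
    push Not at this
    obtain ⟨φ, hφ, h⟩ := this
    have hcl : ∀ x w, Quotient.mk (M.equivOn Φ) x = Quotient.mk _ w → (M.Sat x φ ↔ M.Sat w φ) :=
      fun x w hxw => Quotient.exact hxw φ hφ
    by_cases hy : M.Sat y φ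
    · refine ⟨φ, fun x => ⟨fun hx => (hcl x y hx).2 hy, fun hx _ => ?_⟩⟩
      rw [hcl x z hx]; tauto
    · refine ⟨neg φ, fun x => ⟨fun hx => ?_, fun hx _ => ?_⟩⟩
      · rw [Model.sat_neg, hcl x y hx]; exact hy
      · rw [Model.sat_neg, hcl x z hx]; tauto
  choose θ hθ using hsep
  have hχ := fun a => exists_finite_conj.{u} fun b => θ (a, b)
  choose χ hχ using hχ
  have hχ' : ∀ a x, M.Sat x (χ a) ↔ Quotient.mk _ x = a := by
    intro a x
    rw [hχ]
    refine ⟨fun h => ?_, fun h b => (hθ (a, b) x).1 h⟩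
    by_contra hne
    exact (hθ (a, Quotient.mk _ x) x).2 rfl (Ne.symm hne) (h _)
  -- Only conjunctions are at hand, so `P` is defined by excluding every class outside it.
  obtain ⟨δ, hδ⟩ := exists_finite_conj.{u}
    fun a : {a : Quotient (M.equivOn Φ) // ¬ P a} => neg (χ a)
  refine ⟨δ, fun x => ?_⟩
  simp only [hδ, Model.sat_neg, hχ', Subtype.forall]
  exact ⟨fun h => by_contra fun hc => h _ hc rfl, fun h a ha hx => ha (hx ▸ h)⟩

/-! ### Filtrations and the finite model property -/

theorem mem_sub_self (φ : Formula S) : φ ∈ sub φ := by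
  cases φ <;> simp [sub]

theorem SubClosed.imp {Γ : Set (Formula S)} (h : SubClosed Γ) {φ ψ : Formula S}
    (hφ : imp φ ψ ∈ Γ) : φ ∈ Γ ∧ ψ ∈ Γ :=
  ⟨h _ hφ (by simp [sub, mem_sub_self]), h _ hφ (by simp [sub, mem_sub_self])⟩

theorem SubClosed.box {Γ : Set (Formula S)} (h : SubClosed Γ) {e : S} {φ : Formula S}
    (hφ : box e φ ∈ Γ) : φ ∈ Γ :=
  h _ hφ (by simp [sub, mem_sub_self])

theorem finite_sub (φ : Formula S) : (sub φ).Finite := by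
  induction φ with
  | bot => exact Set.finite_singleton _
  | var i => exact Set.finite_singleton _
  | imp φ ψ h1 h2 => exact ((Set.finite_singleton _).union h1).union h2
  | box e φ h => exact (Set.finite_singleton _).union h

theorem subClosed_sub (φ : Formula S) : SubClosed (sub φ) := by
  induction φ with
  | bot => rintro ψ rfl; exact subset_rfl
  | var i => rintro ψ rfl; exact subset_rfl
  | imp φ ψ h1 h2 =>
    rintro χ ((rfl | h) | h)
    · exact subset_rfl
    · exact (h1 χ h).trans fun _ h => Or.inl (Or.inr h)
    · exact (h2 χ h).trans fun _ h => Or.inr h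
  | box e φ h1 =>
    rintro χ (rfl | h)
    · exact subset_rfl
    · exact (h1 χ h).trans fun _ h => Or.inr h

/-- The filtration lemma: `min_le` moves a box from the quotient to `M`, and `le_max` moves it back.
-/
theorem IsFiltration.sat_iff {M : Model S W} {Γ : Set (Formula S)} {s : Setoid W}
    {N : Model S (Quotient s)} (h : IsFiltration M Γ s N) (hΓ : SubClosed Γ) (φ : Formula S) :
    φ ∈ Γ → ∀ x, N.Sat (Quotient.mk s x) φ ↔ M.Sat x φ := by
  induction φ with
  | bot => exact fun _ _ => Iff.rfl
  | var i => exact fun hi x => h.val_iff i hi x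
  | imp φ ψ ih1 ih2 =>
    exact fun hi x => imp_congr (ih1 (hΓ.imp hi).1 x) (ih2 (hΓ.imp hi).2 x)
  | box e φ ih =>
    refine fun hi x => ⟨fun hx y hy => ?_, fun hx b => ?_⟩
    · exact (ih (hΓ.box hi) y).1 (hx _ (h.min_le e _ _ ⟨x, y, rfl, rfl, hy⟩))
    · obtain ⟨y, rfl⟩ := Quotient.exists_rep b
      exact fun hy => (ih (hΓ.box hi) y).2 (h.le_max e x y hy φ hi hx)

/-- The quotient of a model by modal equivalence. -/
def Model.collapse (M : Model S W) : Model S (Quotient (M.equivOn Set.univ)) where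
  nonempty := M.nonempty.map (Quotient.mk _)
  rel e a b := ∃ x y, Quotient.mk _ x = a ∧ Quotient.mk _ y = b ∧ M.rel e x y
  val i a := ∃ x, Quotient.mk _ x = a ∧ M.val i x

theorem Model.isFiltration_collapse [Finite W] (M : Model S W) :
    IsFiltration M Set.univ (M.equivOn Set.univ) M.collapse where
  finite_index := inferInstance
  respects _ _ h := h
  val_iff i _ x :=
    ⟨fun ⟨_, hy, h⟩ => (Quotient.exact hy (var i) trivial).1 h, fun h => ⟨x, rfl, h⟩⟩
  min_le _ _ _ h := h
  le_max e x y h φ _ hx := by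
    obtain ⟨x', y', hx', hy', h⟩ := h
    exact (Quotient.exact hy' φ trivial).1 ((Quotient.exact hx' (box e φ) trivial).2 hx y' h)

/-- After the collapse every subset is definable, so an arbitrary valuation amounts to a
substitution, under which `L` is closed. Without the collapse, a model of `L` need not be based on a
frame of `L`. -/
theorem Model.collapse_valid [Finite W] {L : Set (Formula S)} (hL : IsNormalLogic L)
    {M : Model S W} (hM : M.Models L) : ∀ φ ∈ L, M.collapse.Valid φ := by
  intro φ hφ V
  have hsat := fun φ => M.isFiltration_collapse.sat_iff (fun _ _ => Set.subset_univ _) φ trivial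
  have hδ := fun i => M.exists_definable Set.univ (V i)
  choose δ hδ using hδ
  intro a
  obtain ⟨x, rfl⟩ := Quotient.exists_rep a
  have h1 := (hsat (φ.subst δ) x).2 (hM _ (hL.subst δ φ hφ) x)
  rw [Model.sat_subst] at h1
  refine Frame.sat_congr (fun i b => ?_) h1
  obtain ⟨y, rfl⟩ := Quotient.exists_rep b
  exact (hsat _ y).trans (hδ i y)

theorem AdmitsDefinableFiltration.exists_finite_frame {L : Set (Formula S)}
    (hL : IsNormalLogic L) (h : AdmitsDefinableFiltration (Mod.{u} L)) {φ : Formula S}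
    (hφ : φ ∉ L) :
    ∃ (W : Type u) (F : Frame S W), Finite W ∧ (∀ ψ ∈ L, F.Valid ψ) ∧ ¬ F.Valid φ := by
  obtain ⟨W, M, x, hM, hx⟩ := hL.exists_model.{u} hφ
  obtain ⟨Φ, _, N, hN, hf⟩ := h (sub φ) (finite_sub φ) (subClosed_sub φ) W M hM
  have := hf.finite_index
  refine ⟨_, N.collapse.toFrame, inferInstance, N.collapse_valid hL hN, fun hc => hx ?_⟩
  rw [← hf.sat_iff (subClosed_sub φ) φ (mem_sub_self φ) x,
    ← N.isFiltration_collapse.sat_iff (fun _ _ => Set.subset_univ _) φ trivial]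
  exact hc N.collapse.val _

theorem AdmitsDefinableFiltration.hasFMP {L : Set (Formula S)} (hL : IsNormalLogic L)
    (h : AdmitsDefinableFiltration (Mod.{u} L)) : HasFMP.{u} L := by
  refine ⟨fun W => {F | Finite W ∧ ∀ ψ ∈ L, F.Valid ψ}, fun W ⟨F, hF⟩ => hF.1, ?_⟩
  ext φ
  refine ⟨fun hφ W F hF => hF.2 φ hφ, fun hφ => ?_⟩
  by_contra hc
  obtain ⟨W, F, h1, h2, h3⟩ := h.exists_finite_frame hL hc
  exact h3 (hφ W F ⟨h1, h2⟩)

theorem HasFMP.kripkeComplete {L : Set (Formula S)} (h : HasFMP.{u} L) : KripkeComplete.{u} L :=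
  h.imp fun _ h => h.2

/-! ### Definable filtrations for the expansions -/

/-- The standard expansion of a frame. -/
def Frame.sharp (F : Frame S W) : Frame (Sharp S) W where
  nonempty := F.nonempty
  rel
    | .base e => F.rel e
    | .comp e c => fun x y => ∃ z, F.rel e x z ∧ F.rel c z y
    | .union e c => fun x y => F.rel e x y ∨ F.rel c x y
    | .plus e => Relation.TransGen (F.rel e)

theorem Frame.sharp_valid (F : Frame S W) {φ : Formula (Sharp S)} (hφ : PDLAxiom φ) :
    F.sharp.Valid φ := by
  intro V x
  cases hφ with
  | union e c =>
    simp only [Model.sat_iff, Model.sat_and, Model.sat_box, Frame.sharp]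
    exact ⟨fun h => ⟨fun y hy => h y (.inl hy), fun y hy => h y (.inr hy)⟩,
      fun h y hy => hy.elim (h.1 y) (h.2 y)⟩
  | comp e c =>
    simp only [Model.sat_iff, Model.sat_box, Frame.sharp]
    exact ⟨fun h z hz y hy => h y ⟨z, hz, hy⟩, fun h y ⟨z, hz, hy⟩ => h z hz y hy⟩
  | plus_sub e => exact fun h y hy => h y (.single hy)
  | plus_step e => exact fun h y hy z hz => h z (.head hy hz)
  | plus_ind e =>
    intro h h' y hy
    induction hy with
    | single hy => exact h' _ hy
    | tail hy hz ih => exact h _ hy ih _ hz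

/-- In the standard expansion of a finite frame, the new modalities are expressible. -/
theorem exists_equivalent [Finite W] (N : Model S W) (σ : ℕ → Formula S) (φ : Formula (Sharp S)) :
    ∃ ψ : Formula S, ∀ x,
      (Model.mk N.toFrame.sharp fun i x => N.Sat x (σ i)).Sat x φ ↔ N.Sat x ψ := by
  induction φ with
  | bot => exact ⟨bot, fun _ => Iff.rfl⟩
  | var i => exact ⟨σ i, fun _ => Iff.rfl⟩
  | imp φ ψ h1 h2 =>
    obtain ⟨φ', h1⟩ := h1
    obtain ⟨ψ', h2⟩ := h2
    exact ⟨imp φ' ψ', fun x => imp_congr (h1 x) (h2 x)⟩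
  | box e φ h =>
    obtain ⟨φ', h⟩ := h
    simp only [Model.sat_box, h]
    cases e with
    | base e => exact ⟨box e φ', fun x => Iff.rfl⟩
    | union e c =>
      refine ⟨Formula.and (box e φ') (box c φ'), fun x => ?_⟩
      simp only [Model.sat_and, Model.sat_box, Frame.sharp]
      exact ⟨fun h => ⟨fun y hy => h y (.inl hy), fun y hy => h y (.inr hy)⟩,
        fun h y hy => hy.elim (h.1 y) (h.2 y)⟩
    | comp e c =>
      refine ⟨box e (box c φ'), fun x => ?_⟩
      exact ⟨fun h z hz y hy => h y ⟨z, hz, hy⟩, fun h y ⟨z, hz, hy⟩ => h z hz y hy⟩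
    | plus e =>
      -- Truth along the transitive closure is truth after every number `k + 1 ≥ 1` of steps;
      -- finiteness of the model makes this infinite conjunction a formula.
      obtain ⟨θ, hθ⟩ := N.exists_conj fun k : ℕ => (box e)^[k + 1] φ'
      refine ⟨θ, fun x => (Iff.trans ?_ (hθ x).symm)⟩
      constructor
      · intro hx k
        induction k generalizing x with
        | zero => exact fun y hy => hx y (.single hy)
        | succ k ih =>
          rw [Function.iterate_succ_apply']
          exact fun y hy => ih y fun z hz => hx z (.head hy hz)
      · intro hx y hy
        induction hy using Relation.TransGen.head_induction_on with
        | single hxy => exact hx 0 _ hxy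
        | head hxz _ ih =>
          refine ih fun k => ?_
          have := hx (k + 1)
          rw [Function.iterate_succ_apply'] at this
          exact this _ hxz

/-- The formulas true under all substitutions form a normal logic, so only the generators need
checking. For members of `L`, the substituted formulas are replaced by base equivalents and closure
of `L` under substitution applies; the other axioms are valid in the frame. -/
theorem sharp_models [Finite W] {L : Set (Formula S)} (hL : IsNormalLogic L) {N : Model S W}
    (hN : N.Models L) (σ : ℕ → Formula S) :
    (Model.mk N.toFrame.sharp fun i x => N.Sat x (σ i)).Models (sharpLogic L) := by
  set M := Model.mk N.toFrame.sharp fun i x => N.Sat x (σ i) with hM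
  intro φ hφ x
  have key := hφ _ M.isNormalLogic_subst (by
    rintro ψ (⟨ψ, hψ, rfl⟩ | hψ)
    · intro τ y
      have h := fun i => exists_equivalent N σ (τ i)
      choose ρ hρ using h
      refine (sat_mapAlphabet _ _ _ _ _).2 ?_
      exact Frame.sat_congr (fun i z => (hρ i z).symm)
        ((Model.sat_subst N ρ ψ y).1 (hN _ (hL.subst ρ ψ hψ) y))
    · intro τ y
      exact N.toFrame.sharp_valid hψ _ y)
  exact key var x

/-- Let `δ` define the set of points whose class is an `e`-successor of `[x]` in the expanded
quotient. It suffices that `[e]δ` holds at `x`, and this follows from the axiom for `e` instantiated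
at `δ`. -/
theorem sharp_rel_of_models {L : Set (Formula S)} {M : Model (Sharp S) W}
    (hM : M.Models (sharpLogic L)) {Φ : Set (Formula (Sharp S))}
    [Finite (Quotient (M.equivOn Φ))] (F : Frame S (Quotient (M.equivOn Φ)))
    (hF : ∀ e x y, M.rel (.base e) x y → F.rel e (Quotient.mk _ x) (Quotient.mk _ y))
    (e : Sharp S) (x y : W) (hxy : M.rel e x y) :
    F.sharp.rel e (Quotient.mk _ x) (Quotient.mk _ y) := by
  obtain ⟨δ, hδ⟩ := M.exists_definable Φ fun b => F.sharp.rel e (Quotient.mk _ x) b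
  have hax : ∀ φ, PDLAxiom φ → M.Sat x (φ.subst fun _ => δ) := fun φ hφ =>
    hM _ ((isNormalLogic_smallestLogic _).subst _ _ fun L' _ h => h (Or.inr hφ)) x
  rw [← hδ]
  cases e with
  | base e => exact (hδ y).2 (hF e x y hxy)
  | union e c =>
    have h := hax _ (.union e c)
    change M.Sat x (Formula.iff (box _ δ) (Formula.and (box _ δ) (box _ δ))) at h
    simp only [Model.sat_iff, Model.sat_and, Model.sat_box] at h
    exact h.2 ⟨fun z hz => (hδ z).2 (.inl (hF _ _ _ hz)), fun z hz => (hδ z).2 (.inr (hF _ _ _ hz))⟩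
      y hxy
  | comp e c =>
    have h := hax _ (.comp e c)
    change M.Sat x (Formula.iff (box _ δ) (box _ (box _ δ))) at h
    simp only [Model.sat_iff, Model.sat_box] at h
    exact h.2 (fun z hz w hw => (hδ w).2 ⟨_, hF _ _ _ hz, hF _ _ _ hw⟩) y hxy
  | plus e =>
    have h : M.Sat x (imp (box (.plus e) (imp δ (box (.base e) δ)))
      (imp (box (.base e) δ) (box (.plus e) δ))) := hax _ (.plus_ind e)
    refine h (fun z _ hz w hw => ?_) (fun z hz => ?_) y hxy
    · exact (hδ w).2 (Relation.TransGen.tail ((hδ z).1 hz) (hF _ _ _ hw))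
    · exact (hδ z).2 (.single (hF _ _ _ hz))

/-- Boxes with base symbols are added to `Γ` since `[e ∘ c]φ` unfolds to `[e][c]φ`, and crossing the
`e`-step requires the intermediate `[c]φ` to be named. For `e⁺` the intermediate formula is `[e⁺]φ`,
which is already in `Γ`. -/
theorem AdmitsDefinableFiltration.sharp [Finite S] {L : Set (Formula S)} (hL : IsNormalLogic L)
    (h : AdmitsDefinableFiltration (Mod.{u} L)) :
    AdmitsDefinableFiltration (Mod.{u} (sharpLogic L)) := by
  intro Γ hΓfin hΓ W M hM
  -- the finite set of formulas that are named by letters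
  let Γ₀ : Set (Formula (Sharp S)) := Γ ∪ (fun p : S × Formula (Sharp S) =>
    box (.base p.1) p.2) '' (Set.univ ×ˢ Γ)
  have hΓ₀fin : Γ₀.Finite := hΓfin.union ((Set.finite_univ.prod hΓfin).image _)
  obtain ⟨τ, hτ⟩ : ∃ τ : ℕ → Formula (Sharp S), Γ₀ ⊆ Set.range τ := by
    rcases Γ₀.eq_empty_or_nonempty with h0 | h0
    · exact ⟨fun _ => bot, by simp [h0]⟩
    · obtain ⟨τ, hτ⟩ := hΓ₀fin.countable.exists_eq_range h0
      exact ⟨τ, hτ.subset⟩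
  -- The letter naming each formula; the value 0 outside `Γ₀` is irrelevant.
  have hq : ∀ φ, ∃ i, φ ∈ Γ₀ → τ i = φ := fun φ => by
    by_cases hφ : φ ∈ Γ₀
    · exact (hτ hφ).imp fun _ h _ => h
    · exact ⟨0, fun h => absurd h hφ⟩
  choose q hq using hq
  let M' : Model S W := ⟨M.toFrame.reduct .base, fun i x => M.Sat x (τ i)⟩
  have hM'sat : ∀ φ x, M'.Sat x φ ↔ M.Sat x ((φ.mapAlphabet .base).subst τ) := fun φ x => by
    rw [Model.sat_subst]
    exact (sat_mapAlphabet _ _ _ _ _).symm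
  have hM' : M' ∈ Mod.{u} L W := fun φ hφ x => (hM'sat φ x).2
    (hM _ ((isNormalLogic_smallestLogic _).subst _ _ fun L' _ h => h (Or.inl ⟨φ, hφ, rfl⟩)) x)
  let Γ' : Set (Formula S) := (fun φ => var (q φ)) '' Γ₀ ∪
    (fun p : S × Formula (Sharp S) => box p.1 (var (q p.2))) '' (Set.univ ×ˢ Γ₀)
  have hvar : ∀ φ ∈ Γ₀, var (q φ) ∈ Γ' := fun φ hφ => Or.inl ⟨φ, hφ, rfl⟩
  have hbox : ∀ e, ∀ φ ∈ Γ₀, box e (var (q φ)) ∈ Γ' :=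
    fun e φ hφ => Or.inr ⟨(e, φ), ⟨trivial, hφ⟩, rfl⟩
  have hΓ'fin : Γ'.Finite :=
    (hΓ₀fin.image _).union ((Set.finite_univ.prod hΓ₀fin).image _)
  have hΓ' : SubClosed Γ' := by
    rintro φ (⟨ψ, hψ, rfl⟩ | ⟨⟨e, ψ⟩, ⟨_, hψ⟩, rfl⟩)
    · rintro _ rfl; exact hvar ψ hψ
    · rintro _ (rfl | rfl)
      · exact hbox e ψ hψ
      · exact hvar ψ hψ
  obtain ⟨Ψ, hΨ, N', hN', hf⟩ := h Γ' hΓ'fin hΓ' W M' hM'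
  refine ⟨(fun φ => (φ.mapAlphabet .base).subst τ) '' Ψ, hΨ.image _, ?_⟩
  have heq : M'.equivOn Ψ = M.equivOn ((fun φ => (φ.mapAlphabet .base).subst τ) '' Ψ) := by
    ext x y
    refine ⟨?_, fun hxy φ hφ => ?_⟩
    · rintro hxy _ ⟨φ, hφ, rfl⟩
      simpa only [hM'sat] using hxy φ hφ
    · rw [hM'sat, hM'sat]
      exact hxy _ ⟨φ, hφ, rfl⟩
  -- The filtration lives on a quotient of `M'`. Since both equivalences coincide, it is carried
  -- over to the quotient of `M` by the translated formulas.
  revert N'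
  rw [heq]
  generalize (fun φ => (φ.mapAlphabet .base).subst τ) '' Ψ = Φ
  intro N' hN' hf
  have := hf.finite_index
  have hΓΓ₀ : ∀ φ ∈ Γ, φ ∈ Γ₀ := fun φ hφ => Or.inl hφ
  have hboxΓ₀ : ∀ e, ∀ φ ∈ Γ, box (.base e) φ ∈ Γ₀ :=
    fun e φ hφ => Or.inr ⟨(e, φ), ⟨trivial, hφ⟩, rfl⟩
  have hmax : ∀ e, ∀ φ ∈ Γ₀, ∀ x y, N'.rel e (Quotient.mk _ x) (Quotient.mk _ y) →
      M.Sat x (box (.base e) φ) → M.Sat y φ := by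
    intro e φ hφ x y hxy hx
    have := hf.le_max e x y hxy _ (hbox e φ hφ) fun z hz => by
      change M.Sat z (τ (q φ))
      rw [hq φ hφ]
      exact hx z hz
    change M.Sat y (τ (q φ)) at this
    rwa [hq φ hφ] at this
  have hPDL : ∀ φ, PDLAxiom φ → ∀ ψ x, M.Sat x (φ.subst fun _ => ψ) := fun φ hφ ψ =>
    hM _ ((isNormalLogic_smallestLogic _).subst _ _ fun L' _ h => h (Or.inr hφ))
  refine ⟨⟨N'.toFrame.sharp, fun i x => N'.Sat x (var (q (var i)))⟩,
    sharp_models hL hN' fun i => var (q (var i)), hf.finite_index, ?_, ?_, ?_, ?_⟩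
  · intro x y hxy φ hφ
    have := hf.respects x y hxy _ (hvar φ (hΓΓ₀ φ hφ))
    change M.Sat x (τ (q φ)) ↔ M.Sat y (τ (q φ)) at this
    rwa [hq φ (hΓΓ₀ φ hφ)] at this
  · intro i hi x
    have := hf.val_iff _ (hvar _ (hΓΓ₀ _ hi)) x
    change _ ↔ M.Sat x (τ (q (var i))) at this
    rw [hq _ (hΓΓ₀ _ hi)] at this
    exact this
  · rintro e _ _ ⟨x, y, rfl, rfl, hxy⟩
    exact sharp_rel_of_models hM N'.toFrame
      (fun e x y hxy => hf.min_le e _ _ ⟨x, y, rfl, rfl, hxy⟩) e x y hxy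
  · intro e x y hxy φ hφ hx
    have hφ' := hΓ.box hφ
    cases e with
    | base e => exact hmax e φ (hΓΓ₀ φ hφ') x y hxy hx
    | union e c =>
      have h : M.Sat x (Formula.iff (box _ φ) (Formula.and (box _ φ) (box _ φ))) :=
        hPDL _ (.union e c) φ x
      rw [Model.sat_iff, Model.sat_and] at h
      rcases hxy with hxy | hxy
      · exact hmax e φ (hΓΓ₀ φ hφ') x y hxy (h.1 hx).1
      · exact hmax c φ (hΓΓ₀ φ hφ') x y hxy (h.1 hx).2
    | comp e c =>
      have h : M.Sat x (Formula.iff (box _ φ) (box _ (box _ φ))) := hPDL _ (.comp e c) φ x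
      rw [Model.sat_iff] at h
      obtain ⟨b, hxz, hzy⟩ := hxy
      obtain ⟨z, rfl⟩ := Quotient.exists_rep b
      exact hmax c φ (hΓΓ₀ φ hφ') z y hzy
        (hmax e _ (hboxΓ₀ c φ hφ') x z hxz (h.1 hx))
    | plus e =>
      -- Truth of `[e⁺]φ` is passed from point to point along the chain; the last step uses `[e⁺]φ →
      -- [e]φ`.
      change Relation.TransGen (N'.rel e) (Quotient.mk _ x) (Quotient.mk _ y) at hxy
      generalize ha : Quotient.mk _ x = a at hxy
      induction hxy using Relation.TransGen.head_induction_on generalizing x with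
      | single hab =>
        subst ha
        exact hmax e φ (hΓΓ₀ φ hφ') x y hab (hPDL _ (.plus_sub e) φ x hx)
      | @head a c hac _ ih =>
        subst ha
        obtain ⟨z, rfl⟩ := Quotient.exists_rep c
        exact ih z (hmax e _ (hΓΓ₀ _ hφ) x z hac (hPDL _ (.plus_step e) φ x hx)) rfl

end ModalLogic

/-! ### Recursively enumerable predicates -/

section Computability

variable {α β : Type*} [Primcodable α] [Primcodable β]

/-- The projection of a computable predicate is recursively enumerable. -/
theorem ComputablePred.exists_re {p : α → β → Prop}
    (h : ComputablePred fun q : α × β => p q.1 q.2) : REPred fun a => ∃ b, p a b := by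
  obtain ⟨f, h, hp⟩ := ComputablePred.computable_iff.1 h
  have hp' : ∀ a b, p a b ↔ f (a, b) = true := fun a b => iff_of_eq (congrFun hp (a, b))
  -- Unbounded search over numbers, each decoded as a candidate witness.
  have hf : Computable₂ fun (a : α) (n : ℕ) => (Encodable.decode (α := β) n).bind fun b =>
      bif f (a, b) then some () else none := by
    refine Computable.option_bind (Computable.decode.comp Computable.snd) ?_
    exact Computable.cond (h.comp ((Computable.fst.comp Computable.fst).pair Computable.snd))
      (Computable.const _) (Computable.const _)
  refine (Partrec.rfindOpt hf).dom_re.of_eq fun a => ?_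
  rw [Nat.rfindOpt_dom]
  constructor
  · rintro ⟨n, x, hx⟩
    simp only [Option.mem_def, Option.bind_eq_some_iff] at hx
    obtain ⟨b, -, hb⟩ := hx
    refine ⟨b, (hp' a b).2 ?_⟩
    cases hfb : f (a, b) with
    | true => rfl
    | false => rw [hfb] at hb; exact nomatch hb
  · rintro ⟨b, hb⟩
    exact ⟨Encodable.encode b, (), by simp [(hp' a b).1 hb]⟩

theorem REPred.or {p q : α → Prop} (hp : REPred p) (hq : REPred q) :
    REPred fun a => p a ∨ q a := by
  obtain ⟨k, hk, h⟩ := Partrec.merge' hp hq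
  refine hk.dom_re.of_eq fun a => ?_
  rw [(h a).2]
  simp [Part.assert]

theorem ComputablePred.and {p q : α → Prop} (hp : ComputablePred p) (hq : ComputablePred q) :
    ComputablePred fun a => p a ∧ q a := by
  obtain ⟨_, hp⟩ := hp
  obtain ⟨_, hq⟩ := hq
  exact ⟨inferInstance, (Primrec.and.to_comp.comp hp hq).of_eq fun a => by simp⟩

theorem ComputablePred.comp {p : β → Prop} (hp : ComputablePred p) {f : α → β}
    (hf : Computable f) : ComputablePred fun a => p (f a) := by
  obtain ⟨_, hp⟩ := hp
  exact ⟨inferInstance, hp.comp hf⟩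

theorem PrimrecPred.forall_mem {p : α → β → Prop} {l : α → List β}
    (hp : PrimrecPred fun q : α × β => p q.1 q.2) (hl : Primrec l) :
    PrimrecPred fun a => ∀ b ∈ l a, p a b :=
  (PrimrecRel.forall_mem_list (R := fun b a => p a b)
    (hp.comp (Primrec.snd.pair Primrec.fst))).comp hl Primrec.id

theorem PrimrecPred.exists_mem {p : α → β → Prop} {l : α → List β}
    (hp : PrimrecPred fun q : α × β => p q.1 q.2) (hl : Primrec l) :
    PrimrecPred fun a => ∃ b ∈ l a, p a b :=
  (PrimrecRel.exists_mem_list (R := fun b a => p a b)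
    (hp.comp (Primrec.snd.pair Primrec.fst))).comp hl Primrec.id

theorem PrimrecPred.mem {f : α → β} {l : α → List β} (hf : Primrec f) (hl : Primrec l) :
    PrimrecPred fun a => f a ∈ l a :=
  (PrimrecPred.exists_mem (p := fun a b => b = f a)
    (Primrec.eq.comp Primrec.snd (hf.comp Primrec.fst)) hl).of_eq fun a => by simp

theorem PrimrecPred.imp {p q : α → Prop} (hp : PrimrecPred p) (hq : PrimrecPred q) :
    PrimrecPred fun a => p a → q a :=
  (hp.not.or hq).of_eq fun a => by tauto

theorem Primrec.filter_of {p : α → β → Prop} [∀ a, DecidablePred (p a)] {l : α → List β}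
    (hp : PrimrecPred fun q : α × β => p q.1 q.2) (hl : Primrec l) :
    Primrec fun a => (l a).filter (p a ·) :=
  (PrimrecRel.listFilter (R := fun b a => p a b)
    (hp.comp (Primrec.snd.pair Primrec.fst))).comp hl Primrec.id

theorem Primrec.map_const {ι : Type*} (l : List ι) {f : ι → α → β} (hf : ∀ i, Primrec (f i)) :
    Primrec fun a => l.map fun i => f i a := by
  induction l with
  | nil => exact Primrec.const _
  | cons i l ih => exact Primrec.list_cons.comp (hf i) ih

theorem Primrec.flatMap_const {ι : Type*} (l : List ι) {f : ι → α → List β}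
    (hf : ∀ i, Primrec (f i)) : Primrec fun a => l.flatMap fun i => f i a := by
  induction l with
  | nil => exact Primrec.const _
  | cons i l ih => exact Primrec.list_append.comp (hf i) ih

/-- Each new head doubles the list of sublists, so a right fold computes it. It serves to list all
relevant valuations on a finite frame. -/
theorem Primrec.sublists' : Primrec (List.sublists' : List α → List (List α)) := by
  refine (Primrec.list_foldr (f := fun l : List α => l) (g := fun _ => [[]])
    (h := fun _ q => q.2 ++ q.2.map (List.cons q.1)) Primrec.id (Primrec.const _) ?_).of_eq
    fun l => ?_
  · have h2 : Primrec fun x : List α × α × List (List α) => x.2.2 :=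
      Primrec.snd.comp Primrec.snd
    exact Primrec.list_append.comp h2 (Primrec.list_map h2
      (Primrec.list_cons.comp (Primrec.fst.comp (Primrec.snd.comp Primrec.fst)) Primrec.snd))
  · induction l with
    | nil => rfl
    | cons a l ih => rw [List.sublists'_cons, ← ih]; rfl

end Computability

/-- The elements generated by a rule that produces finitely many conclusions from a finite list of
premises and a numerical parameter. -/
inductive Generated {X : Type*} (step : List X → ℕ → List X) : X → Prop
  | mk (l : List X) (m : ℕ) (x : X) : (∀ y ∈ l, Generated step y) → x ∈ step l m →
      Generated step x

/-! ### Inductive generation as execution of finite programs -/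

namespace Generated

variable {X : Type*}

/-- One round of the generation process: each instruction selects premises by their position. -/
def exec (step : List X → ℕ → List X) (T : List X) (c : List ℕ × ℕ) : List X :=
  step (c.1.filterMap (T[·]?)) c.2 ++ T

/-- The elements produced by a list of instructions. -/
def run (step : List X → ℕ → List X) (prog : List (List ℕ × ℕ)) : List X :=
  prog.foldl (exec step) []

theorem of_mem_foldl {step : List X → ℕ → List X} (prog : List (List ℕ × ℕ)) (T : List X)
    (hT : ∀ y ∈ T, Generated step y) : ∀ y ∈ prog.foldl (exec step) T, Generated step y := by
  induction prog generalizing T with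
  | nil => exact hT
  | cons c prog ih =>
    refine ih _ fun y hy => ?_
    rcases List.mem_append.1 hy with hy | hy
    · refine .mk _ _ _ (fun z hz => ?_) hy
      obtain ⟨i, -, hi⟩ := List.mem_filterMap.1 hz
      exact hT z (List.mem_of_getElem? hi)
    · exact hT y hy

/-- The starting list is arbitrary so that programs for the single premises can be concatenated,
each run on the output of the previous ones without losing anything. -/
theorem exists_foldl_of_forall {step : List X → ℕ → List X} (l : List X)
    (hl : ∀ x ∈ l, ∀ T : List X, ∃ prog : List (List ℕ × ℕ),
      (∀ y ∈ T, y ∈ prog.foldl (exec step) T) ∧ x ∈ prog.foldl (exec step) T) (T : List X) :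
    ∃ prog : List (List ℕ × ℕ), (∀ y ∈ T, y ∈ prog.foldl (exec step) T) ∧
      ∀ x ∈ l, x ∈ prog.foldl (exec step) T := by
  induction l generalizing T with
  | nil => exact ⟨[], fun y hy => hy, by simp⟩
  | cons a l ih =>
    obtain ⟨p, hp, ha⟩ := hl a (by simp) T
    obtain ⟨q, hq, hlq⟩ := ih (fun x hx => hl x (by simp [hx])) (p.foldl (exec step) T)
    refine ⟨p ++ q, fun y hy => ?_, fun x hx => ?_⟩
    · rw [List.foldl_append]; exact hq y (hp y hy)
    · rw [List.foldl_append]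
      rcases List.mem_cons.1 hx with rfl | hx
      · exact hq x ha
      · exact hlq x hx

theorem exists_filterMap {l T : List X} (h : ∀ x ∈ l, x ∈ T) :
    ∃ is : List ℕ, is.filterMap (T[·]?) = l := by
  induction l with
  | nil => exact ⟨[], rfl⟩
  | cons a l ih =>
    obtain ⟨is, his⟩ := ih fun x hx => h x (by simp [hx])
    obtain ⟨i, hi⟩ := List.mem_iff_getElem?.1 (h a (by simp))
    exact ⟨i :: is, by simp [hi, his]⟩

theorem exists_foldl {step : List X → ℕ → List X} {x : X} (hx : Generated step x) :
    ∀ T : List X, ∃ prog : List (List ℕ × ℕ),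
      (∀ y ∈ T, y ∈ prog.foldl (exec step) T) ∧ x ∈ prog.foldl (exec step) T := by
  induction hx with
  | mk l m x _ hx ih =>
    intro T
    obtain ⟨p, hp, hl⟩ := exists_foldl_of_forall l ih T
    obtain ⟨is, his⟩ := exists_filterMap hl
    refine ⟨p ++ [(is, m)], fun y hy => ?_, ?_⟩
    · simp only [List.foldl_append, List.foldl_cons, List.foldl_nil, exec]
      exact List.mem_append_right _ (hp y hy)
    · simp only [List.foldl_append, List.foldl_cons, List.foldl_nil, exec, his]
      exact List.mem_append_left _ hx

theorem iff_exists_run {step : List X → ℕ → List X} {x : X} :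
    Generated step x ↔ ∃ prog, x ∈ run step prog :=
  ⟨fun h => (h.exists_foldl []).imp fun _ h => h.2,
    fun ⟨prog, h⟩ => of_mem_foldl prog [] (by simp) x h⟩

theorem primrec_run {P X : Type*} [Primcodable P] [Primcodable X]
    {step : P → List X → ℕ → List X}
    (hstep : Primrec fun q : P × List X × ℕ => step q.1 q.2.1 q.2.2) :
    Primrec fun q : P × List (List ℕ × ℕ) => run (step q.1) q.2 := by
  refine Primrec.list_foldl (h := fun q r => exec (step q.1) r.1 r.2) Primrec.snd
    (Primrec.const []) ?_
  have hT : Primrec fun r : (P × List (List ℕ × ℕ)) × List X × List ℕ × ℕ => r.2.1 :=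
    Primrec.fst.comp Primrec.snd
  have hc : Primrec fun r : (P × List (List ℕ × ℕ)) × List X × List ℕ × ℕ => r.2.2 :=
    Primrec.snd.comp Primrec.snd
  refine Primrec.list_append.comp (hstep.comp ((Primrec.fst.comp Primrec.fst).pair
    ((Primrec.listFilterMap (Primrec.fst.comp hc) ?_).pair (Primrec.snd.comp hc)))) hT
  exact Primrec.list_getElem?.comp (hT.comp Primrec.fst) Primrec.snd

theorem rePred {X : Type*} [Primcodable X] {step : List X → ℕ → List X}
    (hstep : Primrec fun q : List X × ℕ => step q.1 q.2) : REPred (Generated step) := by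
  have h : Primrec fun q : Unit × List (List ℕ × ℕ) => run step q.2 :=
    primrec_run (step := fun _ => step) (hstep.comp Primrec.snd)
  refine (ComputablePred.exists_re (p := fun x prog => x ∈ run step prog)
    (PrimrecPred.mem Primrec.fst
      (h.comp ((Primrec.const ()).pair Primrec.snd))).computablePred).of_eq fun x => ?_
  exact iff_exists_run.symm

end Generated

namespace ModalLogic

open Formula

variable {S T : Type} {W : Type u}

/-! ### Codes -/

/-- The code of an implication. -/
def impCode (a b : ℕ) : ℕ := Nat.pair 2 (Nat.pair a b)

/-- The code of a boxed formula. -/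
def boxCode (e a : ℕ) : ℕ := Nat.pair 3 (Nat.pair e a)

section

variable {α : Type*} [Primcodable α] {f g : α → ℕ}

theorem primrec_impCode (hf : Primrec f) (hg : Primrec g) :
    Primrec fun a => impCode (f a) (g a) :=
  Primrec₂.natPair.comp (Primrec.const 2) (Primrec₂.natPair.comp hf hg)

theorem primrec_boxCode (hf : Primrec f) (hg : Primrec g) :
    Primrec fun a => boxCode (f a) (g a) :=
  Primrec₂.natPair.comp (Primrec.const 3) (Primrec₂.natPair.comp hf hg)

end

/-- Rules that generate the numbers that are not codes of formulas, relative to the set `E` of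
codes of modalities. -/
def nonCodeStep (E : List ℕ) (l : List ℕ) (m : ℕ) : List ℕ :=
  [Nat.pair (m.unpair.1 + 4) m.unpair.2, Nat.pair 0 (m + 1), impCode (l.getD 0 (Nat.pair 4 0)) m,
    impCode m (l.getD 0 (Nat.pair 4 0)), boxCode m (l.getD 0 (Nat.pair 4 0)),
    if m.unpair.1 ∈ E then Nat.pair 4 0 else boxCode m.unpair.1 m.unpair.2]

theorem primrec_nonCodeStep (E : List ℕ) :
    Primrec fun q : List ℕ × ℕ => nonCodeStep E q.1 q.2 := by
  have h0 : Primrec fun q : List ℕ × ℕ => q.1.getD 0 (Nat.pair 4 0) :=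
    (Primrec.list_getD _).comp Primrec.fst (Primrec.const 0)
  have hm : Primrec fun q : List ℕ × ℕ => q.2 := Primrec.snd
  have h1 : Primrec fun q : List ℕ × ℕ => q.2.unpair.1 :=
    Primrec.fst.comp (Primrec.unpair.comp hm)
  have h2 : Primrec fun q : List ℕ × ℕ => q.2.unpair.2 :=
    Primrec.snd.comp (Primrec.unpair.comp hm)
  refine Primrec.list_cons.comp (Primrec₂.natPair.comp
    (Primrec.nat_add.comp h1 (Primrec.const 4)) h2) ?_
  refine Primrec.list_cons.comp (Primrec₂.natPair.comp (Primrec.const 0)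
    (Primrec.succ.comp hm)) ?_
  refine Primrec.list_cons.comp (primrec_impCode h0 hm) ?_
  refine Primrec.list_cons.comp (primrec_impCode hm h0) ?_
  refine Primrec.list_cons.comp (primrec_boxCode hm h0) ?_
  exact Primrec.list_cons.comp (Primrec.ite (PrimrecPred.mem h1 (Primrec.const E))
    (Primrec.const _) (primrec_boxCode h1 h2)) (Primrec.const [])

/-- A number fails to be a code by its tag, by a bad payload under tag 0, by a bad modality, or by a
component that is not a code. The default `Nat.pair 4 0` is itself not a code, since constructor
tags stop at 3. -/
theorem generated_nonCodeStep {ι : S → ℕ} {E : List ℕ} (hE : ∀ n, n ∈ E ↔ ∃ e, ι e = n) (n : ℕ) :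
    Generated (nonCodeStep E) n ↔ ¬ ∃ φ : Formula S, code ι φ = n := by
  constructor
  · intro h
    induction h with
    | mk l m x _ hx ih =>
      have h4 : ∀ k r, ¬ ∃ φ : Formula S, code ι φ = Nat.pair (k + 4) r := by
        rintro k r ⟨φ, hφ⟩
        cases φ <;> simp [code, Nat.pair_eq_pair] at hφ
      have h0 : ¬ ∃ φ : Formula S, code ι φ = l.getD 0 (Nat.pair 4 0) := by
        cases l with
        | nil => exact h4 0 0
        | cons a l => exact ih a (by simp)
      simp only [nonCodeStep, List.mem_cons, List.not_mem_nil, or_false] at hx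
      rcases hx with rfl | rfl | rfl | rfl | rfl | rfl
      · exact h4 _ _
      · rintro ⟨φ, hφ⟩
        cases φ <;> simp [code, Nat.pair_eq_pair] at hφ
      · rintro ⟨φ, hφ⟩
        cases φ <;> simp only [code, impCode, Nat.pair_eq_pair] at hφ <;> try omega
        exact h0 ⟨_, hφ.2.1⟩
      · rintro ⟨φ, hφ⟩
        cases φ <;> simp only [code, impCode, Nat.pair_eq_pair] at hφ <;> try omega
        exact h0 ⟨_, hφ.2.2⟩
      · rintro ⟨φ, hφ⟩
        cases φ <;> simp only [code, boxCode, Nat.pair_eq_pair] at hφ <;> try omega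
        exact h0 ⟨_, hφ.2.2⟩
      · split_ifs with hm
        · exact h4 0 0
        · rintro ⟨φ, hφ⟩
          cases φ <;> simp only [code, boxCode, Nat.pair_eq_pair] at hφ <;> try omega
          exact hm ((hE _).2 ⟨_, hφ.2.1⟩)
  · induction n using Nat.strong_induction_on with
    | _ n ih =>
      intro hn
      obtain ⟨k, r, rfl⟩ : ∃ k r, n = Nat.pair k r := ⟨_, _, (Nat.pair_unpair n).symm⟩
      have hmem : ∀ l m x, (∀ y ∈ l, Generated (nonCodeStep E) y) → x ∈ nonCodeStep E l m →
        Generated (nonCodeStep E) x := fun l m x => .mk l m x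
      match k with
      | 0 =>
        match r with
        | 0 => exact absurd ⟨bot, rfl⟩ hn
        | r + 1 => exact hmem [] r _ (by simp) (by simp [nonCodeStep])
      | 1 => exact absurd ⟨var r, rfl⟩ hn
      | 2 =>
        -- Components of a pair with a positive tag are smaller, which feeds the strong induction.
        have hlt : r < Nat.pair 2 r :=
          lt_of_lt_of_le (by omega) (Nat.add_le_pair 2 r)
        obtain ⟨a, b, rfl⟩ : ∃ a b, r = Nat.pair a b := ⟨_, _, (Nat.pair_unpair r).symm⟩
        by_cases ha : ∃ φ : Formula S, code ι φ = a
        · have hb : ¬ ∃ φ : Formula S, code ι φ = b := by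
            rintro ⟨ψ, rfl⟩
            obtain ⟨φ, rfl⟩ := ha
            exact hn ⟨imp φ ψ, rfl⟩
          exact hmem [b] a _ (by simpa using ih b ((Nat.right_le_pair a b).trans_lt hlt) hb)
            (by simp [nonCodeStep, impCode])
        · exact hmem [a] b _ (by simpa using ih a ((Nat.left_le_pair a b).trans_lt hlt) ha)
            (by simp [nonCodeStep, impCode])
      | 3 =>
        have hlt : r < Nat.pair 3 r :=
          lt_of_lt_of_le (by omega) (Nat.add_le_pair 3 r)
        obtain ⟨a, b, rfl⟩ : ∃ a b, r = Nat.pair a b := ⟨_, _, (Nat.pair_unpair r).symm⟩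
        by_cases ha : a ∈ E
        · have hb : ¬ ∃ φ : Formula S, code ι φ = b := by
            rintro ⟨ψ, rfl⟩
            obtain ⟨e, rfl⟩ := (hE _).1 ha
            exact hn ⟨box e ψ, rfl⟩
          exact hmem [b] a _ (by simpa using ih b ((Nat.right_le_pair a b).trans_lt hlt) hb)
            (by simp [nonCodeStep, boxCode])
        · exact hmem [] (Nat.pair a b) _ (by simp)
            (by simp [nonCodeStep, boxCode, ha])
      | k + 4 => exact hmem [] (Nat.pair k r) _ (by simp) (by simp [nonCodeStep])

theorem exists_list_range [Finite S] (ι : S → ℕ) : ∃ E : List ℕ, ∀ n, n ∈ E ↔ ∃ e, ι e = n := by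
  have := Fintype.ofFinite S
  exact ⟨Finset.univ.toList.map ι, by simp⟩

theorem rePred_not_code [Finite S] (ι : S → ℕ) :
    REPred fun n => ¬ ∃ φ : Formula S, code ι φ = n := by
  obtain ⟨E, hE⟩ := exists_list_range ι
  exact (Generated.rePred (primrec_nonCodeStep E)).of_eq (generated_nonCodeStep hE)

/-! ### Finitely axiomatizable logics are recursively enumerable -/

namespace Formula

/-- A strict upper bound of the letters of a formula. -/
def varBound : Formula S → ℕ
  | bot => 0
  | var i => i + 1
  | imp φ ψ => max (varBound φ) (varBound ψ)
  | box _ φ => varBound φ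

theorem subst_congr {σ τ : ℕ → Formula S} (φ : Formula S) (h : ∀ i < φ.varBound, σ i = τ i) :
    φ.subst σ = φ.subst τ := by
  induction φ with
  | bot => rfl
  | var i => exact h i (Nat.lt_succ_self i)
  | imp φ ψ h1 h2 =>
    simp only [subst]
    rw [h1 fun i hi => h i (lt_max_of_lt_left hi), h2 fun i hi => h i (lt_max_of_lt_right hi)]
  | box e φ ih => simp only [subst]; rw [ih h]

theorem subst_var (φ : Formula S) : φ.subst var = φ := by
  induction φ with
  | bot => rfl
  | var i => rfl
  | imp φ ψ h1 h2 => simp only [subst, h1, h2]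
  | box e φ ih => simp only [subst, ih]

theorem subst_subst (σ τ : ℕ → Formula S) (φ : Formula S) :
    (φ.subst σ).subst τ = φ.subst fun i => (σ i).subst τ := by
  induction φ with
  | bot => rfl
  | var i => rfl
  | imp φ ψ h1 h2 => simp only [subst, h1, h2]
  | box e φ ih => simp only [subst, ih]

/-- The code of a substitution instance, computed from the codes of the substituted formulas. -/
def codeSubst (ι : S → ℕ) (c : ℕ → ℕ) : Formula S → ℕ
  | bot => Nat.pair 0 0
  | var i => c i
  | imp φ ψ => impCode (codeSubst ι c φ) (codeSubst ι c ψ)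
  | box e φ => boxCode (ι e) (codeSubst ι c φ)

theorem codeSubst_eq (ι : S → ℕ) {c : ℕ → ℕ} {f : ℕ → Formula S} (h : ∀ i, code ι (f i) = c i)
    (φ : Formula S) : codeSubst ι c φ = code ι (φ.subst f) := by
  induction φ with
  | bot => rfl
  | var i => exact (h i).symm
  | imp φ ψ h1 h2 => simp only [subst, code, codeSubst, impCode, h1, h2]
  | box e φ ih => simp only [subst, code, codeSubst, boxCode, ih]

theorem primrec_codeSubst {α : Type*} [Primcodable α] (ι : S → ℕ) {c : α → ℕ → ℕ}
    (hc : ∀ i, Primrec fun a => c a i) (φ : Formula S) :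
    Primrec fun a => codeSubst ι (c a) φ := by
  induction φ with
  | bot => exact Primrec.const _
  | var i => exact hc i
  | imp φ ψ h1 h2 => exact primrec_impCode h1 h2
  | box e φ ih => exact primrec_boxCode (Primrec.const _) ih

end Formula

/-- Derivations in a Hilbert calculus whose axioms are closed under substitution. -/
inductive Derivable (A : Set (Formula S)) : Formula S → Prop
  | ax (φ : Formula S) (σ : ℕ → Formula S) : φ ∈ A → Derivable A (φ.subst σ)
  | weaken (φ ψ : Formula S) : Derivable A (imp φ (imp ψ φ))
  | distrib (φ ψ χ : Formula S) :
      Derivable A (imp (imp φ (imp ψ χ)) (imp (imp φ ψ) (imp φ χ)))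
  | exfalso (φ : Formula S) : Derivable A (imp bot φ)
  | cases (φ ψ χ : Formula S) : Derivable A (imp (imp ψ φ) (imp (imp (imp ψ χ) φ) φ))
  | axiomK (e : S) (φ ψ : Formula S) :
      Derivable A (imp (box e (imp φ ψ)) (imp (box e φ) (box e ψ)))
  | mp (φ ψ : Formula S) : Derivable A (imp φ ψ) → Derivable A φ → Derivable A ψ
  | nec (e : S) (φ : Formula S) : Derivable A φ → Derivable A (box e φ)

/-- Tautologies are derivable by Lindenbaum's lemma, so the infinite stock of tautologies reduces to
four schemes. Substitution need not be a rule, because all axioms are already closed under it. -/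
theorem isNormalLogic_derivable (A : Set (Formula S)) : IsNormalLogic {φ | Derivable A φ} where
  taut φ h := by
    by_contra hc
    have hT : IsTheory {φ | Derivable A φ} :=
      ⟨.weaken, .distrib, .exfalso, .cases, .mp⟩
    obtain ⟨v, hv, -, hvφ⟩ := hT.exists_valuation hc
    exact hvφ (h v hv.1 hv.2)
  axiomK e := .axiomK e _ _
  mp := .mp
  subst σ φ h := by
    induction h with
    | ax φ τ hφ => rw [Set.mem_ofPred_eq, subst_subst]; exact .ax φ _ hφ
    | weaken φ ψ => exact .weaken _ _
    | distrib φ ψ χ => exact .distrib _ _ _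
    | exfalso φ => exact .exfalso _
    | cases φ ψ χ => exact .cases _ _ _
    | axiomK e φ ψ => exact .axiomK e _ _
    | mp φ ψ _ _ h1 h2 => exact .mp _ _ h1 h2
    | nec e φ _ h => exact .nec e _ h
  nec := .nec

theorem derivable_of_mem_smallestLogic {A : Set (Formula S)} {φ : Formula S}
    (h : φ ∈ smallestLogic A) : Derivable A φ :=
  h _ (isNormalLogic_derivable A) fun ψ hψ => by
    have := Derivable.ax ψ var hψ
    rwa [subst_var] at this

/-- Rules that generate the codes of formulas (tagged `false`) and of the members of a finitely
axiomatizable logic (tagged `true`). -/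
def derivStep (ι : S → ℕ) (es : List S) (As : List (Formula S)) (l : List (Bool × ℕ)) (m : ℕ) :
    List (Bool × ℕ) :=
  let d : Bool × ℕ := (false, Nat.pair 0 0)
  let c : ℕ → ℕ := fun i => (l.getD i d).2
  [d, (false, Nat.pair 1 m), (false, impCode (c 0) (c 1)),
    (true, impCode (c 0) (impCode (c 1) (c 0))),
    (true, impCode (impCode (c 0) (impCode (c 1) (c 2)))
      (impCode (impCode (c 0) (c 1)) (impCode (c 0) (c 2)))),
    (true, impCode (Nat.pair 0 0) (c 0)),
    (true, impCode (impCode (c 1) (c 0)) (impCode (impCode (impCode (c 1) (c 2)) (c 0)) (c 0))),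
    if l.getD 2 d = (true, impCode (c 0) (c 1)) ∧ (l.getD 0 d).1 = true then (true, c 1) else d] ++
  (es.flatMap fun e => [(false, boxCode (ι e) (c 0)),
    (true, impCode (boxCode (ι e) (impCode (c 0) (c 1)))
      (impCode (boxCode (ι e) (c 0)) (boxCode (ι e) (c 1)))),
    if (l.getD 0 d).1 = true then (true, boxCode (ι e) (c 0)) else d]) ++
  As.map fun φ => (true, codeSubst ι c φ)

theorem primrec_derivStep (ι : S → ℕ) (es : List S) (As : List (Formula S)) :
    Primrec fun q : List (Bool × ℕ) × ℕ => derivStep ι es As q.1 q.2 := by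
  have hd : ∀ i : ℕ, Primrec fun q : List (Bool × ℕ) × ℕ => q.1.getD i (false, Nat.pair 0 0) :=
    fun i => (Primrec.list_getD _).comp Primrec.fst (Primrec.const i)
  have hc : ∀ i : ℕ, Primrec fun q : List (Bool × ℕ) × ℕ =>
      (q.1.getD i (false, Nat.pair 0 0)).2 := fun i => Primrec.snd.comp (hd i)
  have hb : PrimrecPred fun q : List (Bool × ℕ) × ℕ =>
      (q.1.getD 0 (false, Nat.pair 0 0)).1 = true :=
    Primrec.eq.comp (Primrec.fst.comp (hd 0)) (Primrec.const true)
  have tag : ∀ (b : Bool) {f : List (Bool × ℕ) × ℕ → ℕ}, Primrec f →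
      Primrec fun q => (b, f q) := fun b f hf => (Primrec.const b).pair hf
  refine Primrec.list_append.comp (Primrec.list_append.comp ?_ ?_) ?_
  · refine Primrec.list_cons.comp (Primrec.const _) ?_
    refine Primrec.list_cons.comp
      (tag _ (Primrec₂.natPair.comp (Primrec.const 1) Primrec.snd)) ?_
    refine Primrec.list_cons.comp (tag _ (primrec_impCode (hc 0) (hc 1))) ?_
    refine Primrec.list_cons.comp
      (tag _ (primrec_impCode (hc 0) (primrec_impCode (hc 1) (hc 0)))) ?_
    refine Primrec.list_cons.comp (tag _ (primrec_impCode
      (primrec_impCode (hc 0) (primrec_impCode (hc 1) (hc 2)))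
      (primrec_impCode (primrec_impCode (hc 0) (hc 1)) (primrec_impCode (hc 0) (hc 2))))) ?_
    refine Primrec.list_cons.comp (tag _ (primrec_impCode (Primrec.const _) (hc 0))) ?_
    refine Primrec.list_cons.comp (tag _ (primrec_impCode (primrec_impCode (hc 1) (hc 0))
      (primrec_impCode (primrec_impCode (primrec_impCode (hc 1) (hc 2)) (hc 0)) (hc 0)))) ?_
    refine Primrec.list_cons.comp (Primrec.ite (PrimrecPred.and ?_ hb) (tag _ (hc 1))
      (Primrec.const _)) (Primrec.const [])
    exact Primrec.eq.comp (hd 2) (tag _ (primrec_impCode (hc 0) (hc 1)))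
  · refine Primrec.flatMap_const es fun e => ?_
    have hbox : ∀ {f : List (Bool × ℕ) × ℕ → ℕ}, Primrec f →
      Primrec fun q => boxCode (ι e) (f q) := fun hf => primrec_boxCode (Primrec.const _) hf
    refine Primrec.list_cons.comp (tag _ (hbox (hc 0))) ?_
    refine Primrec.list_cons.comp (tag _ (primrec_impCode
      (hbox (primrec_impCode (hc 0) (hc 1))) (primrec_impCode (hbox (hc 0)) (hbox (hc 1))))) ?_
    exact Primrec.list_cons.comp (Primrec.ite hb (tag _ (hbox (hc 0))) (Primrec.const _))
      (Primrec.const [])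
  · exact Primrec.map_const As fun φ => tag _ (primrec_codeSubst ι hc φ)

theorem derivStep_sound {ι : S → ℕ} (hι : Function.Injective ι) (es : List S)
    (As : List (Formula S)) {x : Bool × ℕ} (h : Generated (derivStep ι es As) x) :
    ∃ φ, code ι φ = x.2 ∧ (x.1 = true → φ ∈ smallestLogic {φ | φ ∈ As}) := by
  induction h with
  | mk l m x _ hx ih =>
    have hL := isNormalLogic_smallestLogic {φ | φ ∈ As}
    -- Every premise position holds the code of a formula `f i`, with `⊥` past the end of the list.
    have hf : ∀ i, ∃ φ, code ι φ = (l.getD i (false, Nat.pair 0 0)).2 ∧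
        ((l.getD i (false, Nat.pair 0 0)).1 = true → φ ∈ smallestLogic {φ | φ ∈ As}) := by
      intro i
      rcases lt_or_ge i l.length with hi | hi
      · rw [List.getD_eq_getElem _ _ hi]
        exact ih _ (List.getElem_mem hi)
      · rw [List.getD_eq_default _ _ hi]
        exact ⟨bot, rfl, fun h => nomatch h⟩
    choose f hf hfL using hf
    simp only [derivStep, List.mem_append, List.mem_cons, List.not_mem_nil, or_false,
      List.mem_flatMap, List.mem_map] at hx
    simp only [← hf] at hx
    rcases hx with ((rfl | rfl | rfl | rfl | rfl | rfl | rfl | rfl) |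
      ⟨e, -, (rfl | rfl | rfl)⟩) | ⟨φ, hφ, rfl⟩
    · exact ⟨bot, rfl, fun h => nomatch h⟩
    · exact ⟨var m, rfl, fun h => nomatch h⟩
    · exact ⟨imp _ _, rfl, fun h => nomatch h⟩
    · exact ⟨_, rfl, fun _ => hL.isTheory.weaken (f 0) (f 1)⟩
    · exact ⟨_, rfl, fun _ => hL.isTheory.distrib (f 0) (f 1) (f 2)⟩
    · exact ⟨_, rfl, fun _ => hL.isTheory.exfalso (f 0)⟩
    · exact ⟨_, rfl, fun _ => hL.isTheory.cases (f 0) (f 1) (f 2)⟩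
    · split_ifs with h
      · refine ⟨f 1, rfl, fun _ => hL.mp (f 0) (f 1) ?_ (hfL 0 h.2)⟩
        -- Modus ponens is tested on codes; injectivity of the coding turns the test into an
        -- equality of formulas.
        have h2 : code ι (f 2) = code ι (imp (f 0) (f 1)) := by rw [hf 2, h.1]; rfl
        rw [← code_injective hι h2]
        exact hfL 2 (by rw [h.1])
      · exact ⟨bot, rfl, fun h => nomatch h⟩
    · exact ⟨box e _, rfl, fun h => nomatch h⟩
    · exact ⟨_, rfl, fun _ => hL.box_mp e (f 0) (f 1)⟩
    · split_ifs with h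
      · exact ⟨box e (f 0), rfl, fun _ => hL.nec e _ (hfL 0 h)⟩
      · exact ⟨bot, rfl, fun h => nomatch h⟩
    · exact ⟨φ.subst f, (codeSubst_eq ι (fun _ => rfl) φ).symm,
        fun _ => hL.subst f φ fun L' _ h => h hφ⟩

theorem derivStep_formula (ι : S → ℕ) {es : List S} (hes : ∀ e, e ∈ es) (As : List (Formula S))
    (φ : Formula S) : Generated (derivStep ι es As) (false, code ι φ) := by
  induction φ with
  | bot => exact .mk [] 0 _ (by simp) (by simp [derivStep, code])
  | var i => exact .mk [] i _ (by simp) (by simp [derivStep, code])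
  | imp φ ψ h1 h2 =>
    exact .mk [_, _] 0 _ (by simp only [List.forall_mem_cons]; exact ⟨h1, h2, by simp⟩)
      (by simp [derivStep, code, impCode])
  | box e φ h =>
    refine .mk [_] 0 _ (by simp only [List.forall_mem_cons]; exact ⟨h, by simp⟩)
      (List.mem_append_left _ (List.mem_append_right _ (List.mem_flatMap.2 ⟨e, hes e, ?_⟩)))
    simp [code, boxCode]

theorem derivStep_complete (ι : S → ℕ) {es : List S} (hes : ∀ e, e ∈ es) (As : List (Formula S))
    {φ : Formula S} (h : Derivable {φ | φ ∈ As} φ) :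
    Generated (derivStep ι es As) (true, code ι φ) := by
  have hF := derivStep_formula ι hes As
  induction h with
  | ax φ σ hφ =>
    -- Only letters below `φ.varBound` matter, so finitely many substituted formulas serve as
    -- premises and the default supplies `⊥` for the rest.
    refine .mk ((List.range φ.varBound).map fun i => (false, code ι (σ i))) 0 _ ?_
      (List.mem_append_right _ (List.mem_map.2 ⟨φ, hφ, ?_⟩))
    · intro y hy
      obtain ⟨i, -, rfl⟩ := List.mem_map.1 hy
      exact hF (σ i)
    · rw [subst_congr (σ := σ) (τ := fun i => if i < φ.varBound then σ i else bot) φ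
        fun i hi => by simp [hi]]
      refine Prod.ext rfl (codeSubst_eq ι (fun i => ?_) φ)
      by_cases hi : i < φ.varBound
      · simp [hi]
      · simp [hi, code]
  | weaken φ ψ =>
    exact .mk [_, _] 0 _ (by simp only [List.forall_mem_cons]; exact ⟨hF φ, hF ψ, by simp⟩)
      (by simp [derivStep, code, impCode])
  | distrib φ ψ χ =>
    exact .mk [_, _, _] 0 _
      (by simp only [List.forall_mem_cons]; exact ⟨hF φ, hF ψ, hF χ, by simp⟩)
      (by simp [derivStep, code, impCode])
  | exfalso φ =>
    exact .mk [_] 0 _ (by simp only [List.forall_mem_cons]; exact ⟨hF φ, by simp⟩)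
      (by simp [derivStep, code, impCode])
  | cases φ ψ χ =>
    exact .mk [_, _, _] 0 _
      (by simp only [List.forall_mem_cons]; exact ⟨hF φ, hF ψ, hF χ, by simp⟩)
      (by simp [derivStep, code, impCode])
  | axiomK e φ ψ =>
    refine .mk [_, _] 0 _ (by simp only [List.forall_mem_cons]; exact ⟨hF φ, hF ψ, by simp⟩)
      (List.mem_append_left _ (List.mem_append_right _ (List.mem_flatMap.2 ⟨e, hes e, ?_⟩)))
    simp [code, boxCode, impCode]
  | mp φ ψ _ _ h1 h2 =>
    exact .mk [_, _, _] 0 _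
      (by simp only [List.forall_mem_cons]; exact ⟨h2, hF ψ, h1, by simp⟩)
      (by simp [derivStep, code, impCode])
  | nec e φ _ h =>
    refine .mk [_] 0 _ (by simp only [List.forall_mem_cons]; exact ⟨h, by simp⟩)
      (List.mem_append_left _ (List.mem_append_right _ (List.mem_flatMap.2 ⟨e, hes e, ?_⟩)))
    simp [code, boxCode]

theorem exists_list_univ (α : Type*) [Finite α] : ∃ l : List α, ∀ a, a ∈ l := by
  have := Fintype.ofFinite α
  exact ⟨Finset.univ.toList, by simp⟩

theorem FinitelyAxiomatizable.rePred [Finite S] {L : Set (Formula S)}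
    (h : FinitelyAxiomatizable L) {ι : S → ℕ} (hι : Function.Injective ι) :
    REPred fun n => ∃ φ ∈ L, code ι φ = n := by
  obtain ⟨A, hA, rfl⟩ := h
  obtain ⟨es, hes⟩ := exists_list_univ S
  obtain ⟨As, rfl⟩ : ∃ As : List (Formula S), {φ | φ ∈ As} = A :=
    ⟨hA.toFinset.toList, by ext; simp⟩
  have hG := Generated.rePred (primrec_derivStep ι es As)
  have hG' : REPred fun n => Generated (derivStep ι es As) (true, n) :=
    Partrec.comp hG (Primrec.pair (Primrec.const true) Primrec.id).to_comp
  refine hG'.of_eq fun n => ⟨fun h => ?_, ?_⟩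
  · obtain ⟨φ, h1, h2⟩ := derivStep_sound hι es As h
    exact ⟨φ, h2 rfl, h1⟩
  · rintro ⟨φ, hφ, rfl⟩
    exact derivStep_complete ι hes As (derivable_of_mem_smallestLogic hφ)

/-! ### Finitely presented models -/

/-- The truth set of a letter in a finitely presented model. -/
def varExt (m : ℕ) (v : List (ℕ × ℕ)) (i : ℕ) : List ℕ :=
  (List.range (m + 1)).filter fun x => (i, x) ∈ v

/-- The truth set of an implication. -/
def impExt (m : ℕ) (a b : List ℕ) : List ℕ :=
  (List.range (m + 1)).filter fun x => x ∈ a → x ∈ b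

open Classical in
/-- The truth set of a boxed formula. -/
noncomputable def boxExt (d : ℕ × List (ℕ × ℕ × ℕ)) (e : ℕ) (a : List ℕ) : List ℕ :=
  (List.range (d.1 + 1)).filter fun x => ∀ y ∈ List.range (d.1 + 1), (e, x, y) ∈ d.2 → y ∈ a

/-- The truth set of a formula in a finitely presented model. -/
noncomputable def ext (ι : S → ℕ) (d : ℕ × List (ℕ × ℕ × ℕ)) (v : List (ℕ × ℕ)) : Formula S → List ℕ
  | bot => []
  | var i => varExt d.1 v i
  | imp φ ψ => impExt d.1 (ext ι d v φ) (ext ι d v ψ)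
  | box e φ => boxExt d (ι e) (ext ι d v φ)

/-- The model on a presented frame with the valuation given by a list of pairs. -/
def presentedModel (ι : S → ℕ) (d : ℕ × List (ℕ × ℕ × ℕ)) (v : List (ℕ × ℕ)) :
    Model S (Fin (d.1 + 1)) :=
  ⟨presentedFrame ι d, fun i x => (i, (x : ℕ)) ∈ v⟩

theorem mem_ext (ι : S → ℕ) (d : ℕ × List (ℕ × ℕ × ℕ)) (v : List (ℕ × ℕ)) (φ : Formula S) :
    ∀ x : Fin (d.1 + 1), (x : ℕ) ∈ ext ι d v φ ↔ (presentedModel ι d v).Sat x φ := by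
  induction φ with
  | bot => intro x; simp [ext, Model.Sat]
  | var i => intro x; simp [ext, varExt, Model.Sat, presentedModel, x.is_le]
  | imp φ ψ h1 h2 => intro x; simp [ext, impExt, Model.Sat, h1, h2, x.is_le, imp_iff_not_or]
  | box e φ ih =>
    intro x
    simp only [ext, boxExt, List.mem_filter, List.mem_range, x.2, true_and, decide_eq_true_eq,
      Model.Sat]
    exact ⟨fun h y hy => (ih y).1 (h y y.2 hy), fun h y hy hxy => (ih ⟨y, hy⟩).2 (h ⟨y, hy⟩ hxy)⟩

section

variable {α : Type*} [Primcodable α]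

theorem primrec_points {m : α → ℕ} (hm : Primrec m) :
    Primrec fun a => List.range (m a + 1) :=
  Primrec.list_range.comp (Primrec.succ.comp hm)

theorem primrec_varExt {m : α → ℕ} {v : α → List (ℕ × ℕ)} {i : α → ℕ} (hm : Primrec m)
    (hv : Primrec v) (hi : Primrec i) : Primrec fun a => varExt (m a) (v a) (i a) :=
  Primrec.filter_of (PrimrecPred.mem ((hi.comp Primrec.fst).pair Primrec.snd)
    (hv.comp Primrec.fst)) (primrec_points hm)

theorem primrec_impExt {m : α → ℕ} {a b : α → List ℕ} (hm : Primrec m)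
    (ha : Primrec a) (hb : Primrec b) : Primrec fun x => impExt (m x) (a x) (b x) :=
  Primrec.filter_of ((PrimrecPred.mem Primrec.snd (ha.comp Primrec.fst)).imp
    (PrimrecPred.mem Primrec.snd (hb.comp Primrec.fst))) (primrec_points hm)

theorem primrec_boxExt {d : α → ℕ × List (ℕ × ℕ × ℕ)} {e : α → ℕ} {a : α → List ℕ}
    (hd : Primrec d) (he : Primrec e) (ha : Primrec a) :
    Primrec fun x => boxExt (d x) (e x) (a x) := by
  classical
  have hpts := primrec_points (Primrec.fst.comp hd)
  refine Primrec.filter_of (p := fun z x => ∀ y ∈ List.range ((d z).1 + 1),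
    (e z, x, y) ∈ (d z).2 → y ∈ a z) (PrimrecPred.forall_mem
    (p := fun (q : α × ℕ) y => (e q.1, q.2, y) ∈ (d q.1).2 → y ∈ a q.1)
    (PrimrecPred.imp ?_ ?_) (hpts.comp Primrec.fst)) hpts
  · exact PrimrecPred.mem ((he.comp (Primrec.fst.comp Primrec.fst)).pair
      ((Primrec.snd.comp Primrec.fst).pair Primrec.snd))
      (Primrec.snd.comp (hd.comp (Primrec.fst.comp Primrec.fst)))
  · exact PrimrecPred.mem Primrec.snd (ha.comp (Primrec.fst.comp Primrec.fst))

theorem primrec_ext (ι : S → ℕ) {d : α → ℕ × List (ℕ × ℕ × ℕ)} {v : α → List (ℕ × ℕ)}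
    (hd : Primrec d) (hv : Primrec v) (φ : Formula S) : Primrec fun a => ext ι (d a) (v a) φ := by
  induction φ with
  | bot => exact Primrec.const _
  | var i => exact primrec_varExt (Primrec.fst.comp hd) hv (Primrec.const i)
  | imp φ ψ h1 h2 => exact primrec_impExt (Primrec.fst.comp hd) h1 h2
  | box e φ h => exact primrec_boxExt hd (Primrec.const _) h

end

/-- Rules that generate the pairs of a code of a formula and its truth set. -/
noncomputable def extStep (ι : S → ℕ) (es : List S) (p : (ℕ × List (ℕ × ℕ × ℕ)) × List (ℕ × ℕ))
    (l : List (ℕ × List ℕ)) (m : ℕ) : List (ℕ × List ℕ) :=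
  let c : ℕ → ℕ × List ℕ := fun i => l.getD i (Nat.pair 0 0, [])
  [(Nat.pair 0 0, []), (Nat.pair 1 m, varExt p.1.1 p.2 m),
    (impCode (c 0).1 (c 1).1, impExt p.1.1 (c 0).2 (c 1).2)] ++
  es.map fun e => (boxCode (ι e) (c 0).1, boxExt p.1 (ι e) (c 0).2)

theorem primrec_extStep (ι : S → ℕ) (es : List S) :
    Primrec fun q : ((ℕ × List (ℕ × ℕ × ℕ)) × List (ℕ × ℕ)) × List (ℕ × List ℕ) × ℕ =>
      extStep ι es q.1 q.2.1 q.2.2 := by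
  have hc : ∀ i : ℕ, Primrec
      fun q : ((ℕ × List (ℕ × ℕ × ℕ)) × List (ℕ × ℕ)) × List (ℕ × List ℕ) × ℕ =>
        q.2.1.getD i (Nat.pair 0 0, []) := fun i =>
    (Primrec.list_getD _).comp (Primrec.fst.comp Primrec.snd) (Primrec.const i)
  have hc1 := fun i => Primrec.fst.comp (hc i)
  have hc2 := fun i => Primrec.snd.comp (hc i)
  have hp : Primrec fun q : ((ℕ × List (ℕ × ℕ × ℕ)) × List (ℕ × ℕ)) × List (ℕ × List ℕ) × ℕ =>
      q.1 := Primrec.fst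
  have hm : Primrec fun q : ((ℕ × List (ℕ × ℕ × ℕ)) × List (ℕ × ℕ)) × List (ℕ × List ℕ) × ℕ =>
      q.2.2 := Primrec.snd.comp Primrec.snd
  have hd := Primrec.fst.comp hp
  have hd1 := Primrec.fst.comp hd
  refine Primrec.list_append.comp ?_ ?_
  · refine Primrec.list_cons.comp (Primrec.const _) ?_
    refine Primrec.list_cons.comp ((Primrec₂.natPair.comp (Primrec.const 1) hm).pair
      (primrec_varExt hd1 (Primrec.snd.comp hp) hm)) ?_
    exact Primrec.list_cons.comp ((primrec_impCode (hc1 0) (hc1 1)).pair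
      (primrec_impExt hd1 (hc2 0) (hc2 1))) (Primrec.const [])
  · exact Primrec.map_const es fun e => (primrec_boxCode (Primrec.const _) (hc1 0)).pair
      (primrec_boxExt hd (Primrec.const _) (hc2 0))

/-- This makes evaluation uniform in the formula: instead of decoding a number, codes are generated
together with their truth sets. -/
theorem generated_extStep (ι : S → ℕ) {es : List S} (hes : ∀ e, e ∈ es)
    (p : (ℕ × List (ℕ × ℕ × ℕ)) × List (ℕ × ℕ)) (x : ℕ × List ℕ) :
    Generated (extStep ι es p) x ↔ ∃ φ : Formula S, x = (code ι φ, ext ι p.1 p.2 φ) := by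
  constructor
  · intro h
    induction h with
    | mk l m x _ hx ih =>
      have hf : ∀ i, ∃ φ : Formula S,
          l.getD i (Nat.pair 0 0, []) = (code ι φ, ext ι p.1 p.2 φ) := by
        intro i
        rcases lt_or_ge i l.length with hi | hi
        · rw [List.getD_eq_getElem _ _ hi]
          exact ih _ (List.getElem_mem hi)
        · rw [List.getD_eq_default _ _ hi]
          exact ⟨bot, rfl⟩
      choose f hf using hf
      simp only [extStep, hf, List.mem_append, List.mem_cons, List.not_mem_nil, or_false,
        List.mem_map] at hx
      rcases hx with (rfl | rfl | rfl) | ⟨e, -, rfl⟩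
      · exact ⟨bot, rfl⟩
      · exact ⟨var m, rfl⟩
      · exact ⟨imp _ _, rfl⟩
      · exact ⟨box e _, rfl⟩
  · rintro ⟨φ, rfl⟩
    induction φ with
    | bot => exact .mk [] 0 _ (by simp) (by simp [extStep, code, ext])
    | var i => exact .mk [] i _ (by simp) (by simp [extStep, code, ext])
    | imp φ ψ h1 h2 =>
      exact .mk [_, _] 0 _ (by simp only [List.forall_mem_cons]; exact ⟨h1, h2, by simp⟩)
        (by simp [extStep, code, ext, impCode])
    | box e φ h =>
      exact .mk [_] 0 _ (by simp only [List.forall_mem_cons]; exact ⟨h, by simp⟩)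
        (List.mem_append_right _ (List.mem_map.2 ⟨e, hes e, by simp [code, ext, boxCode]⟩))

theorem sat_congr_varBound (F : Frame S W) {V V' : ℕ → W → Prop} (φ : Formula S)
    (h : ∀ i < φ.varBound, ∀ x, V i x ↔ V' i x) :
    ∀ x, (Model.mk F V).Sat x φ ↔ (Model.mk F V').Sat x φ := by
  induction φ with
  | bot => exact fun _ => Iff.rfl
  | var i => exact h i (Nat.lt_succ_self i)
  | imp φ ψ h1 h2 =>
    exact fun x => imp_congr (h1 (fun i hi => h i (lt_max_of_lt_left hi)) x)
      (h2 (fun i hi => h i (lt_max_of_lt_right hi)) x)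
  | box e φ ih => exact fun x => forall_congr' fun y => imp_congr_right fun _ => ih h y

theorem exists_sublist_sat_iff (ι : S → ℕ) (d : ℕ × List (ℕ × ℕ × ℕ))
    (V : ℕ → Fin (d.1 + 1) → Prop) (φ : Formula S) :
    ∃ v ∈ ((List.range φ.varBound).flatMap fun i =>
        (List.range (d.1 + 1)).map fun x => (i, x)).sublists',
      ∀ x, (Model.mk (presentedFrame ι d) V).Sat x φ ↔ (presentedModel ι d v).Sat x φ := by
  classical
  -- The list is cut down to the pairs true under `V`; agreement on the letters of `φ` is enough.
  refine ⟨_, List.mem_sublists'.2 (List.filter_sublist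
    (p := fun q => decide (∃ h : q.2 < d.1 + 1, V q.1 ⟨q.2, h⟩))), ?_⟩
  refine sat_congr_varBound _ φ fun i hi x => ?_
  simp [hi, x.is_le]

/-- Validity of a formula in a finitely presented frame is primitive recursive. -/
theorem primrecPred_valid (ι : S → ℕ) (φ : Formula S) :
    PrimrecPred fun d => (presentedFrame ι d).Valid φ := by
  have hpts : Primrec fun d : ℕ × List (ℕ × ℕ × ℕ) => List.range (d.1 + 1) :=
    primrec_points Primrec.fst
  have hv : Primrec fun d : ℕ × List (ℕ × ℕ × ℕ) => ((List.range φ.varBound).flatMap fun i =>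
      (List.range (d.1 + 1)).map fun x => (i, x)).sublists' :=
    Primrec.sublists'.comp (Primrec.flatMap_const _ fun i =>
      Primrec.list_map hpts (Primrec.pair (Primrec.const i) Primrec.snd))
  have h := PrimrecPred.forall_mem (p := fun (d : ℕ × List (ℕ × ℕ × ℕ)) (v : List (ℕ × ℕ)) =>
    ∀ x ∈ List.range (d.1 + 1), x ∈ ext ι d v φ) (PrimrecPred.forall_mem
    (p := fun (q : (ℕ × List (ℕ × ℕ × ℕ)) × List (ℕ × ℕ)) x => x ∈ ext ι q.1 q.2 φ)
    (PrimrecPred.mem Primrec.snd (primrec_ext ι (Primrec.fst.comp Primrec.fst)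
      (Primrec.snd.comp Primrec.fst) φ)) (hpts.comp Primrec.fst)) hv
  refine h.of_eq fun d => ⟨fun h V x => ?_, fun h v _ x hx => ?_⟩
  · obtain ⟨v, hv, hs⟩ := exists_sublist_sat_iff ι d V φ
    exact (hs x).2 ((mem_ext ι d v φ x).1 (h v hv x (List.mem_range.2 x.2)))
  · exact (mem_ext ι d v φ ⟨x, List.mem_range.1 hx⟩).2 (h _ _)

/-! ### Decidable finite frames and finite axiomatizability under expansion -/

theorem computablePred_forall_valid (ι : S → ℕ) {A : Set (Formula S)} (hA : A.Finite) :
    ComputablePred fun d => ∀ φ ∈ A, (presentedFrame ι d).Valid φ := by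
  induction A, hA using Set.Finite.induction_on with
  | empty =>
    have : PrimrecPred fun _ : ℕ × List (ℕ × ℕ × ℕ) => True :=
      ⟨inferInstance, Primrec.const _⟩
    exact this.computablePred.of_eq fun d => by simp
  | @insert φ _ _ _ ih =>
    exact ((primrecPred_valid ι φ).computablePred.and ih).of_eq fun d => by simp

theorem FinitelyAxiomatizable.decidableFiniteFrames [Finite S] {L : Set (Formula S)}
    (h : FinitelyAxiomatizable L) : DecidableFiniteFrames L := by
  obtain ⟨A, hA, rfl⟩ := h
  intro ι _
  refine (computablePred_forall_valid ι hA).of_eq fun d => ?_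
  exact ⟨fun h φ hφ => hφ _ (presentedFrame ι d).isNormalLogic_valid h,
    fun h φ hφ => h φ fun L' _ hL' => hL' hφ⟩

theorem finite_pdlAxiom [Finite S] : {φ : Formula (Sharp S) | PDLAxiom φ}.Finite := by
  let f : Fin 5 × S × S → Formula (Sharp S) := fun p => match p.1 with
    | 0 => iff (box (.union p.2.1 p.2.2) (var 0))
        (and (box (.base p.2.1) (var 0)) (box (.base p.2.2) (var 0)))
    | 1 => iff (box (.comp p.2.1 p.2.2) (var 0)) (box (.base p.2.1) (box (.base p.2.2) (var 0)))
    | 2 => imp (box (.plus p.2.1) (var 0)) (box (.base p.2.1) (var 0))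
    | 3 => imp (box (.plus p.2.1) (var 0)) (box (.base p.2.1) (box (.plus p.2.1) (var 0)))
    | 4 => imp (box (.plus p.2.1) (imp (var 0) (box (.base p.2.1) (var 0))))
        (imp (box (.base p.2.1) (var 0)) (box (.plus p.2.1) (var 0)))
  refine (Set.finite_range f).subset ?_
  rintro φ (⟨e, c⟩ | ⟨e, c⟩ | e | e | e)
  exacts [⟨(0, e, c), rfl⟩, ⟨(1, e, c), rfl⟩, ⟨(2, e, e), rfl⟩, ⟨(3, e, e), rfl⟩,
    ⟨(4, e, e), rfl⟩]

theorem base_injective : Function.Injective (Sharp.base : S → Sharp S) :=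
  fun _ _ h => Sharp.base.inj h

theorem valid_mapAlphabet (f : S → T) (F : Frame T W) (φ : Formula S) :
    F.Valid (φ.mapAlphabet f) ↔ (F.reduct f).Valid φ :=
  forall_congr' fun V => forall_congr' fun x => sat_mapAlphabet f F V φ x

/-- A frame validates the expanded logic iff its base reduct validates `L` and it validates the
finitely many new axioms. The same data present the reduct, relative to the numbering restricted to
base symbols. -/
theorem DecidableFiniteFrames.sharp [Finite S] {L : Set (Formula S)}
    (h : DecidableFiniteFrames L) : DecidableFiniteFrames (sharpLogic L) := by
  intro ι hι
  refine ((h (ι ∘ Sharp.base) (hι.comp base_injective)).and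
    (computablePred_forall_valid ι finite_pdlAxiom)).of_eq fun d => ?_
  have hmap : ∀ φ : Formula S, (presentedFrame ι d).Valid (φ.mapAlphabet .base) ↔
      (presentedFrame (ι ∘ Sharp.base) d).Valid φ := fun φ => valid_mapAlphabet _ _ φ
  constructor
  · rintro ⟨h1, h2⟩ φ hφ
    refine hφ _ (presentedFrame ι d).isNormalLogic_valid ?_
    rintro _ (⟨ψ, hψ, rfl⟩ | hψ)
    · exact (hmap ψ).2 (h1 ψ hψ)
    · exact h2 _ hψ
  · exact fun h => ⟨fun φ hφ => (hmap φ).1 (h _ fun L' _ hL' => hL' (Or.inl ⟨φ, hφ, rfl⟩)),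
      fun φ hφ => h _ fun L' _ hL' => hL' (Or.inr hφ)⟩

theorem mapAlphabet_subst (f : S → T) (σ : ℕ → Formula S) (φ : Formula S) :
    (φ.subst σ).mapAlphabet f = (φ.mapAlphabet f).subst fun i => (σ i).mapAlphabet f := by
  induction φ with
  | bot => rfl
  | var i => rfl
  | imp φ ψ h1 h2 => simp only [Formula.subst, mapAlphabet, h1, h2]
  | box e φ h => simp only [Formula.subst, mapAlphabet, h]

theorem IsNormalLogic.comap {L : Set (Formula T)} (hL : IsNormalLogic L) (f : S → T) :
    IsNormalLogic (mapAlphabet f ⁻¹' L) where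
  taut φ h := hL.taut _ fun v h0 hv => h (fun ψ => v (ψ.mapAlphabet f)) h0 fun _ _ => hv _ _
  axiomK e := hL.axiomK (f e)
  mp φ ψ := hL.mp _ _
  subst σ φ h := by
    rw [Set.mem_preimage, mapAlphabet_subst]
    exact hL.subst _ _ h
  nec e φ := hL.nec (f e) _

/-- The image of a finite axiom set suffices: the preimage of a normal logic under the embedding is
normal, so it contains all consequences of those axioms. -/
theorem FinitelyAxiomatizable.sharp [Finite S] {L : Set (Formula S)}
    (h : FinitelyAxiomatizable L) : FinitelyAxiomatizable (sharpLogic L) := by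
  obtain ⟨A, hA, rfl⟩ := h
  refine ⟨mapAlphabet .base '' A ∪ {φ | PDLAxiom φ}, (hA.image _).union finite_pdlAxiom, ?_⟩
  ext φ
  constructor
  · intro h L' hL' hA'
    refine h L' hL' ?_
    rintro _ (⟨ψ, hψ, rfl⟩ | hψ)
    · exact hψ _ (hL'.comap .base) fun χ hχ => hA' (Or.inl ⟨χ, hχ, rfl⟩)
    · exact hA' (Or.inr hψ)
  · intro h L' hL' hA'
    refine h L' hL' ?_
    rintro _ (⟨ψ, hψ, rfl⟩ | hψ)
    · exact hA' (Or.inl ⟨ψ, fun L'' _ h => h hψ, rfl⟩)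
    · exact hA' (Or.inr hψ)

/-! ### Decision procedures -/

/-- The frame transported along a bijection. -/
def Frame.transport {W' : Type*} (F : Frame S W) (f : W ≃ W') : Frame S W' where
  nonempty := F.nonempty.map f
  rel e x y := F.rel e (f.symm x) (f.symm y)

theorem Frame.sat_transport {W' : Type*} (F : Frame S W) (f : W ≃ W') (V : ℕ → W' → Prop)
    (φ : Formula S) : ∀ x, (Model.mk (F.transport f) V).Sat x φ ↔
      (Model.mk F fun i y => V i (f y)).Sat (f.symm x) φ := by
  induction φ with
  | bot => exact fun _ => Iff.rfl
  | var i => intro x; simp [Model.Sat]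
  | imp φ ψ h1 h2 => exact fun x => imp_congr (h1 x) (h2 x)
  | box e φ ih =>
    intro x
    simp only [Model.sat_box, ih]
    exact ⟨fun h y hy => by simpa using h (f y) (by simpa [Frame.transport] using hy),
      fun h y hy => h _ hy⟩

theorem Frame.valid_transport {W' : Type*} (F : Frame S W) (f : W ≃ W') (φ : Formula S) :
    (F.transport f).Valid φ ↔ F.Valid φ := by
  constructor
  · intro h V x
    have := (F.sat_transport f (fun i y => V i (f.symm y)) φ (f x)).1 (h _ _)
    simpa using this
  · exact fun h V x => (F.sat_transport f V φ x).2 (h _ _)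

/-- A finite frame is isomorphic to a presented one. -/
theorem exists_presentedFrame_valid_iff [Finite S] [Finite W] {ι : S → ℕ}
    (hι : Function.Injective ι) (F : Frame S W) :
    ∃ d, ∀ φ, (presentedFrame ι d).Valid φ ↔ F.Valid φ := by
  obtain ⟨n, ⟨f⟩⟩ := Finite.exists_equiv_fin W
  cases n with
  | zero => exact F.nonempty.elim fun x => (f x).elim0
  | succ m =>
    obtain ⟨l, hl⟩ := exists_presentedFrame hι m (F.transport f)
    exact ⟨(m, l), fun φ => by rw [hl]; exact F.valid_transport f φ⟩

/-- The witness for a non-theorem is a presented frame of `L`, a finite valuation, and a program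
computing a truth set that misses a point. Checking such a witness is computable, and the finite
model property supplies one. -/
theorem AdmitsDefinableFiltration.coRESet [Finite S] {L : Set (Formula S)}
    (hL : IsNormalLogic L) (h : AdmitsDefinableFiltration (Mod.{u} L))
    (hdec : DecidableFiniteFrames L) : CoRESet L := by
  intro ι hι
  obtain ⟨es, hes⟩ := exists_list_univ S
  let P := ((ℕ × List (ℕ × ℕ × ℕ)) × List (ℕ × ℕ)) × List (List ℕ × ℕ)
  have hrun : PrimrecPred fun q : ℕ × P => ∃ y ∈ Generated.run (extStep ι es q.2.1) q.2.2,
      y.1 = q.1 ∧ ∃ x ∈ List.range (q.2.1.1.1 + 1), x ∉ y.2 := by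
    have hd : Primrec fun q : ℕ × P => q.2.1.1.1 :=
      Primrec.fst.comp (Primrec.fst.comp (Primrec.fst.comp Primrec.snd))
    refine PrimrecPred.exists_mem (PrimrecPred.and ?_ (PrimrecPred.exists_mem ?_ ?_))
      ((Generated.primrec_run (primrec_extStep ι es)).comp Primrec.snd)
    · exact Primrec.eq.comp (Primrec.fst.comp Primrec.snd) (Primrec.fst.comp Primrec.fst)
    · exact (PrimrecPred.mem Primrec.snd (Primrec.snd.comp (Primrec.snd.comp Primrec.fst))).not
    · exact (primrec_points hd).comp Primrec.fst
  have hL' : ComputablePred fun q : ℕ × P => ∀ φ ∈ L, (presentedFrame ι q.2.1.1).Valid φ :=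
    (hdec ι hι).comp (Primrec.fst.comp (Primrec.fst.comp Primrec.snd)).to_comp
  refine (ComputablePred.exists_re (p := fun (n : ℕ) (q : P) =>
    (∀ φ ∈ L, (presentedFrame ι q.1.1).Valid φ) ∧
      ∃ y ∈ Generated.run (extStep ι es q.1) q.2,
        y.1 = n ∧ ∃ x ∈ List.range (q.1.1.1 + 1), x ∉ y.2)
    (hL'.and hrun.computablePred)).of_eq fun n => ?_
  constructor
  · rintro ⟨⟨⟨d, v⟩, prog⟩, hd, y, hy, rfl, x, hx, hxy⟩
    obtain ⟨φ, rfl⟩ := (generated_extStep ι hes (d, v) y).1 (Generated.iff_exists_run.2 ⟨_, hy⟩)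
    refine ⟨φ, fun hφ => hxy ?_, rfl⟩
    exact (mem_ext ι d v φ ⟨x, List.mem_range.1 hx⟩).2 (hd φ hφ _ _)
  · rintro ⟨φ, hφ, rfl⟩
    obtain ⟨W, F, hW, hF, hFφ⟩ := h.exists_finite_frame hL hφ
    obtain ⟨d, hd⟩ := exists_presentedFrame_valid_iff hι F
    have hdφ : ¬ (presentedFrame ι d).Valid φ := fun hc => hFφ ((hd φ).1 hc)
    simp only [Frame.Valid, not_forall] at hdφ
    obtain ⟨V, x, hx⟩ := hdφ
    obtain ⟨v, -, hv⟩ := exists_sublist_sat_iff ι d V φ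
    obtain ⟨prog, hprog⟩ := Generated.iff_exists_run.1
      ((generated_extStep ι hes (d, v) _).2 ⟨φ, rfl⟩)
    exact ⟨((d, v), prog), fun ψ hψ => (hd ψ).2 (hF ψ hψ), _, hprog, rfl, x,
      List.mem_range.2 x.2,
      fun hc => hx ((hv x).2 ((mem_ext ι d v φ x).1 hc))⟩

/-- Post's theorem. The complement is taken in all of `ℕ`, so numbers that code no formula must be
enumerated along with the codes of non-theorems. -/
theorem FinitelyAxiomatizable.decidableSet [Finite S] {L : Set (Formula S)}
    (h : FinitelyAxiomatizable L) (hco : CoRESet L) : DecidableSet L := by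
  intro ι hι
  refine ComputablePred.computable_iff_re_compl_re'.2 ⟨h.rePred hι, ?_⟩
  refine ((rePred_not_code (S := S) ι).or (hco ι hι)).of_eq fun n => ⟨?_, fun hn => ?_⟩
  · rintro (hn | ⟨φ, hφ, rfl⟩) ⟨ψ, hψ, hc⟩
    · exact hn ⟨ψ, hc⟩
    · exact hφ (code_injective hι hc ▸ hψ)
  · by_cases hc : ∃ φ : Formula S, code ι φ = n
    · obtain ⟨φ, rfl⟩ := hc
      exact Or.inr ⟨φ, fun hφ => hn ⟨φ, hφ, rfl⟩, rfl⟩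
    · exact Or.inl hc

/-! ### Iterated expansions -/

theorem IsNormalLogic.iterLogic {L : Set (Formula S)} (hL : IsNormalLogic L) :
    ∀ n, IsNormalLogic (iterLogic L n)
  | 0 => hL
  | _ + 1 => isNormalLogic_smallestLogic _

theorem AdmitsDefinableFiltration.iterLogic [Finite S] {L : Set (Formula S)}
    (hL : IsNormalLogic L) (h : AdmitsDefinableFiltration (Mod.{u} L)) :
    ∀ n, AdmitsDefinableFiltration (Mod.{u} (iterLogic L n))
  | 0 => h
  | n + 1 => (AdmitsDefinableFiltration.iterLogic hL h n).sharp (hL.iterLogic n)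

theorem FinitelyAxiomatizable.iterLogic [Finite S] {L : Set (Formula S)}
    (h : FinitelyAxiomatizable L) : ∀ n, FinitelyAxiomatizable (iterLogic L n)
  | 0 => h
  | n + 1 => (FinitelyAxiomatizable.iterLogic h n).sharp

theorem DecidableFiniteFrames.iterLogic [Finite S] {L : Set (Formula S)}
    (h : DecidableFiniteFrames L) : ∀ n, DecidableFiniteFrames (iterLogic L n)
  | 0 => h
  | n + 1 => (DecidableFiniteFrames.iterLogic h n).sharp

end ModalLogic

theorem mainTheorem3 {S : Type} [Finite S] (L : Set (ModalLogic.Formula S))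
    (hL : ModalLogic.IsNormalLogic L)
    (hADF : ModalLogic.AdmitsDefinableFiltration (ModalLogic.Mod.{u} L)) (n : ℕ) :
    ModalLogic.AdmitsDefinableFiltration (ModalLogic.Mod.{u} (ModalLogic.iterLogic L n)) ∧
    (ModalLogic.HasFMP.{u} (ModalLogic.iterLogic L n) ∧
      ModalLogic.KripkeComplete.{u} (ModalLogic.iterLogic L n)) ∧
    (ModalLogic.FinitelyAxiomatizable L → ModalLogic.DecidableSet (ModalLogic.iterLogic L n)) ∧
    (ModalLogic.DecidableFiniteFrames L → ModalLogic.CoRESet (ModalLogic.iterLogic L n)) := by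
  have hLn := hL.iterLogic n
  have hn := hADF.iterLogic hL n
  have hfmp := hn.hasFMP hLn
  refine ⟨hn, ⟨hfmp, hfmp.kripkeComplete⟩, fun hfin => ?_, fun hdec => ?_⟩
  · exact (hfin.iterLogic n).decidableSet
      (hn.coRESet hLn (hfin.iterLogic n).decidableFiniteFrames)
  · exact hn.coRESet hLn (hdec.iterLogic n)
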